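/- Let $X$ be a three-dimensional real normed space with closed unit ball $B$, and let $S\subset X$ be a set of exactly $6$ points. Call a set equilateral if all distances between distinct points of it equal one and the same number $\lambda>0$; call $S$ homothetic to $T$ if $S=t+rT$ for some $t\in X$ and $r>0$. Write $\triangle a_1a_2a_3=\operatorname{conv}\{a_1,a_2,a_3\}$ and $A-A'=\{x-y: x\in A,\ y\in A'\}$. A semiregular hexagon of side length $\ell$ is a convex hexagon $\operatorname{conv}\{p_1,\dots,p_6\}$ lying in a plane of $X$, with distinct consecutive vertices $p_1,\dots,p_6$ (consecutive sides are allowed to be collinear), whose six sides all have length $\ell$ in the norm, and with $p_1+p_3+p_5=p_2+p_4+p_6$. Then $S$ is equilateral if and only if at least one of the following holds: (1) there are linearly independent $e_1,e_2,e_3\in X$ such that $\operatorname{bd}B$ contains the one-skeleton (the union of the $12$ edges) of the octahedron $\operatorname{conv}\{\pm e_1,\pm e_2,\pm e_3\}$, and $S$ is homothetic to $\{\pm e_1,\pm e_2,\pm e_3\}$; (2) there are triangles $\triangle a_1a_2a_3$ and $\triangle b_1b_2b_3$ lying in parallel planes of $X$, both equilateral in the norm with side length $1$, such that $\triangle a_1a_2a_3-\triangle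 b_1b_2b_3$ is a semiregular hexagon of side length $1$ contained in some two-dimensional face of $B$, and $S$ is homothetic to $\{a_1,a_2,a_3,b_1,b_2,b_3\}$. In particular, if $S$ is equilateral, there are two distinct parallel planes each containing exactly three points of $S$. -/

import Mathlib

open scoped Pointwise

section

variable {E : Type*} [NormedAddCommGroup E] [NormedSpace ℝ E]

/-- All distances between distinct points of `S` are equal to one positive number. -/
def IsEquilateral (S : Set E) : Prop :=
  ∃ l : ℝ, 0 < l ∧ S.Pairwise fun x y => ‖x - y‖ = l

/-- `S` is the image of `T` under a (positive) homothety `v ↦ t + r • v`. -/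
def IsHomothetic (S T : Set E) : Prop :=
  ∃ (t : E) (r : ℝ), 0 < r ∧ S = (fun v => t + r • v) '' T

/-- The set `{±e₁, ±e₂, ±e₃}`. -/
def octahedronVertices (e : Fin 3 → E) : Set E :=
  Set.range e ∪ Set.range fun i => -e i

/-- The one-skeleton of the octahedron `conv {±e₁, ±e₂, ±e₃}`: the union of its twelve edges,
which join the vertices `±eᵢ` to the vertices `±eⱼ` for `i ≠ j`. -/
def octahedronSkeleton (e : Fin 3 → E) : Set E :=
  ⋃ (i : Fin 3) (j : Fin 3) (_ : i ≠ j),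
    segment ℝ (e i) (e j) ∪ segment ℝ (e i) (-e j) ∪ segment ℝ (-e i) (-e j)

/-- `F` is a two-dimensional face of the convex set `C`. -/
structure IsTwoDimFace (C F : Set E) : Prop where
  convex : Convex ℝ F
  isExtreme : IsExtreme ℝ C F
  finrank_eq : Module.finrank ℝ (vectorSpan ℝ F) = 2

/-- The (closed, filled) triangle with vertices `a 0, a 1, a 2`. -/
def triangle (a : Fin 3 → E) : Set E :=
  convexHull ℝ (Set.range a)

/-- The triangle with vertices `a 0, a 1, a 2` is equilateral in the norm, with side length `l`. -/
def IsEquilateralTriangle (l : ℝ) (a : Fin 3 → E) : Prop :=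
  ∀ i j, i ≠ j → ‖a i - a j‖ = l

/-- `p 0, …, p 5` (indices modulo 6) are the consecutive vertices of a semiregular hexagon with all
sides of length `l`. The vertices are distinct and span a plane; the convexity of the hexagon
`p 0 p 1 … p 5` says that every side lies on a line of this plane (cut out by a functional `f` that
is not constant on the plane) which has the whole hexagon on one side.
Consecutive sides are allowed to be collinear. -/
structure IsSemiregularHexagon (l : ℝ) (p : Fin 6 → E) : Prop where
  planar : Module.finrank ℝ (vectorSpan ℝ (Set.range p)) = 2
  injective : Function.Injective p
  supporting : ∀ i, ∃ f : E →ₗ[ℝ] ℝ,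
    f (p (i + 1)) = f (p i) ∧ (∀ j, f (p j) ≤ f (p i)) ∧ ∃ j, f (p j) < f (p i)
  side_length : ∀ i, ‖p (i + 1) - p i‖ = l
  alternating_sum : p 0 + p 2 + p 4 = p 1 + p 3 + p 5

/-- `P` is a plane (a two-dimensional affine subspace). -/
def IsPlane (P : AffineSubspace ℝ E) : Prop :=
  (P : Set E).Nonempty ∧ Module.finrank ℝ P.direction = 2

end

/-! The classification rests on the Gale diagram of six equidistant points of a three-dimensional
space. An equidistant set is antipodal: a norming functional of `x - y` attains its maximum on the
set at `x` and its minimum at `y`. For the affine dependences `∑ c i • x i = 0`, `∑ c i = 0` this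
says that two points on opposite sides of a dependence carry at most half of its total mass
(`dependence_bound`).

The dependences form a plane, so that the points have a Gale diagram of six vectors `g i` of `ℝ²`,
of which only the determinants `D i j = det (g i, g j)` matter (`IsAntipodalForm`). Row `i` of `D`
is the dependence that does not involve the point `x i`. It has two points on one side and at most
three on the other, and by antipodality the coefficients on the side of three are at most those on
the side of two. Orienting the pairs by the sign of `D` gives a tournament with all outdegrees `2`
or `3`, each of them taken three times. If the vertices of outdegree three form a directed cycle, these
inequalities run around the cycle, so that the three determinants are equal and the three vectors
have sum zero. Otherwise the tournament is determined, and a Plücker relation among four vectors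
forces a determinant to vanish, whose pair can be reoriented so as to reach the former case
(`IsAntipodalForm.exists_isInterlacing`).

Hence the points split into two triangles `a` and `b` in parallel planes, and the signs of the
remaining determinants say that the edges of `a` and `-b` alternate (`IsInterlacedPair`). Therefore
`triangle a - triangle b` is a hexagon whose sides are alternately edges of `a` and of `-b`, with
vertices `a i - b i` and `a (i + 1) - b i`. For each of the three other differences
`a i - b (i + 1)`, take a norming functional. If one of these is constant on the plane of `a`, then
it cuts out of the unit ball a face that contains the hexagon. If none is, then the alternation of
edges forces `a i + b i = a (i + 1) + b (i + 1)` for all `i`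
(`IsInterlacedPair.exists_norming_or_add_eq`), and the points are the vertices of an octahedron. -/

open scoped Pointwise

/-! ### Antipodal Gale diagrams of six points -/

/-- The values `D i j = det (g i, g j)` of a Gale diagram `g : Fin 6 → ℝ²` of an antipodal
six-point set. `bound` is antipodality: in an affine dependence, the coefficients of two points on
opposite sides amount to at most half of the total mass. -/
structure IsAntipodalForm (D : Fin 6 → Fin 6 → ℝ) : Prop where
  antisymm : ∀ i j, D i j = -D j i
  plucker : ∀ i j k l, D i j * D k l - D i k * D j l + D i l * D j k = 0
  sum_eq_zero : ∀ i, ∑ j, D i j = 0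
  bound : ∀ i j k, j ≠ k → D i j - D i k + |D i j| + |D i k| ≤ ∑ m, |D i m|
  ne_zero : ∃ i j, D i j ≠ 0

namespace IsAntipodalForm

variable {D : Fin 6 → Fin 6 → ℝ}

theorem diag (h : IsAntipodalForm D) (i : Fin 6) : D i i = 0 := by
  linarith [h.antisymm i i]

theorem perm (h : IsAntipodalForm D) (σ : Equiv.Perm (Fin 6)) :
    IsAntipodalForm fun i j => D (σ i) (σ j) where
  antisymm i j := h.antisymm _ _
  plucker i j k l := h.plucker _ _ _ _
  sum_eq_zero i := by
    rw [Equiv.sum_comp σ (fun j => D (σ i) j)]; exact h.sum_eq_zero _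
  bound i j k hjk := by
    rw [Equiv.sum_comp σ (fun m => |D (σ i) m|)]
    exact h.bound _ _ _ (σ.injective.ne hjk)
  ne_zero := by
    obtain ⟨i, j, hij⟩ := h.ne_zero
    exact ⟨σ.symm i, σ.symm j, by simpa using hij⟩

end IsAntipodalForm

/-- Four coplanar antipodal points form a parallelogram: the coefficients of their affine
dependence have equal absolute values. -/
theorem abs_eq_of_four {a b c d : ℝ} (hs : a + b + c + d = 0)
    (hab : a - b ≤ |c| + |d|) (hba : b - a ≤ |c| + |d|)
    (hac : a - c ≤ |b| + |d|) (hca : c - a ≤ |b| + |d|)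
    (had : a - d ≤ |b| + |c|) (hda : d - a ≤ |b| + |c|)
    (hbc : b - c ≤ |a| + |d|) (hcb : c - b ≤ |a| + |d|)
    (hbd : b - d ≤ |a| + |c|) (hdb : d - b ≤ |a| + |c|)
    (hcd : c - d ≤ |a| + |b|) (hdc : d - c ≤ |a| + |b|) :
    |a| = |b| ∧ |a| = |c| ∧ |a| = |d| := by
  rcases abs_cases a with ⟨ha, ha'⟩ | ⟨ha, ha'⟩ <;>
  rcases abs_cases b with ⟨hb, hb'⟩ | ⟨hb, hb'⟩ <;>
  rcases abs_cases c with ⟨hc, hc'⟩ | ⟨hc, hc'⟩ <;>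
  rcases abs_cases d with ⟨hd, hd'⟩ | ⟨hd, hd'⟩ <;>
  refine ⟨?_, ?_, ?_⟩ <;> linarith

/-- The Plücker relation fails for six nonzero numbers of equal absolute value. -/
theorem eq_zero_of_plucker {X Y Z c : ℝ} (hX : X ^ 2 = c ^ 4) (hY : Y ^ 2 = c ^ 4)
    (hZ : Z ^ 2 = c ^ 4) (h : X - Y + Z = 0) : c = 0 := by
  have hXY : X = Y - Z := by linarith
  have h1 : 2 * (Y * Z) = c ^ 4 := by rw [hXY] at hX; linarith
  have h2 : (Y * Z) ^ 2 = c ^ 8 := by rw [mul_pow, hY, hZ]; ring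
  have h3 : (2 * (Y * Z)) ^ 2 = c ^ 8 := by rw [h1]; ring
  have h4 : c ^ 8 = 0 := by linarith
  exact (pow_eq_zero_iff (by norm_num)).1 h4

namespace IsAntipodalForm

variable {D : Fin 6 → Fin 6 → ℝ}

/-- The zeroth vector of the Gale diagram is nonzero. Otherwise the other five points would be
coplanar with any four of them forming a parallelogram. -/
theorem exists_ne_of_zero (h : IsAntipodalForm D) : ∃ j, D 0 j ≠ 0 := by
  by_contra! h0
  have h0' : ∀ j, D j 0 = 0 := fun j => by rw [h.antisymm, h0, neg_zero]
  -- Each other row has at most four nonzero entries, which have equal absolute values.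
  have key : ∀ i j k l m : Fin 6, (Finset.univ : Finset (Fin 6)) = {0, i, j, k, l, m} →
      ([0, i, j, k, l, m] : List (Fin 6)).Nodup →
      |D i j| = |D i k| ∧ |D i j| = |D i l| ∧ |D i j| = |D i m| := by
    intro i j k l m hu hn
    have hS : ∀ f : Fin 6 → ℝ, ∑ x, f x = f 0 + (f i + (f j + (f k + (f l + f m)))) := by
      intro f
      simp only [List.nodup_cons, List.mem_cons, not_or, List.not_mem_nil] at hn
      rw [hu, Finset.sum_insert, Finset.sum_insert, Finset.sum_insert, Finset.sum_insert,
        Finset.sum_pair] <;> simp <;> tauto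
    have hsum := h.sum_eq_zero i
    rw [hS, h0', h.diag] at hsum
    have hb : ∀ a b, a ≠ b → D i a - D i b + |D i a| + |D i b| ≤
        |D i j| + (|D i k| + (|D i l| + |D i m|)) := by
      intro a b hab
      have := h.bound i a b hab
      rw [hS, h0', h.diag] at this
      simpa using this
    simp only [List.nodup_cons, List.mem_cons, not_or, List.not_mem_nil] at hn
    obtain ⟨-, -, ⟨hjk, hjl, hjm, -⟩, ⟨hkl, hkm, -⟩, ⟨hlm, -⟩, -⟩ := hn
    apply abs_eq_of_four (by linarith)
    · linarith [hb j k hjk]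
    · linarith [hb k j (Ne.symm hjk)]
    · linarith [hb j l hjl]
    · linarith [hb l j (Ne.symm hjl)]
    · linarith [hb j m hjm]
    · linarith [hb m j (Ne.symm hjm)]
    · linarith [hb k l hkl]
    · linarith [hb l k (Ne.symm hkl)]
    · linarith [hb k m hkm]
    · linarith [hb m k (Ne.symm hkm)]
    · linarith [hb l m hlm]
    · linarith [hb m l (Ne.symm hlm)]
  have hsymm : ∀ i j, |D i j| = |D j i| := fun i j => by rw [h.antisymm, abs_neg]
  obtain ⟨a12, a13, a14⟩ := key 1 2 3 4 5 (by decide) (by decide)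
  obtain ⟨b12, b13, b14⟩ := key 2 1 3 4 5 (by decide) (by decide)
  obtain ⟨c12, c13, c14⟩ := key 3 1 2 4 5 (by decide) (by decide)
  obtain ⟨d12, d13, d14⟩ := key 4 1 2 3 5 (by decide) (by decide)
  have s12 := hsymm 1 2
  have s13 := hsymm 1 3
  have s14 := hsymm 1 4
  have s23 := hsymm 2 3
  have s24 := hsymm 2 4
  have s34 := hsymm 3 4
  set c := |D 1 2| with hc
  have sq : ∀ i j, |D i j| = c → D i j ^ 2 = c ^ 2 := fun i j hij => by rw [← hij, sq_abs]
  have e12 := sq 1 2 rfl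
  have e13 := sq 1 3 (by linarith)
  have e14 := sq 1 4 (by linarith)
  have e23 := sq 2 3 (by linarith)
  have e24 := sq 2 4 (by linarith)
  have e34 := sq 3 4 (by linarith)
  -- The three products in the Plücker relation have the same absolute value.
  have hc0 : c = 0 := by
    have hp := h.plucker 1 2 3 4
    have hX : (D 1 2 * D 3 4) ^ 2 = c ^ 4 := by rw [mul_pow, e12, e34]; ring
    have hY : (D 1 3 * D 2 4) ^ 2 = c ^ 4 := by rw [mul_pow, e13, e24]; ring
    have hZ : (D 1 4 * D 2 3) ^ 2 = c ^ 4 := by rw [mul_pow, e14, e23]; ring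
    exact eq_zero_of_plucker hX hY hZ hp
  obtain ⟨f12, f13, f14⟩ := key 5 1 2 3 4 (by decide) (by decide)
  have s15 := hsymm 1 5
  obtain ⟨i, j, hij⟩ := h.ne_zero
  apply hij
  rw [← abs_eq_zero]
  have hd : ∀ i, |D i i| = 0 := fun i => by simp [h.diag]
  have hz : ∀ i, |D 0 i| = 0 := fun i => by simp [h0]
  have hz' : ∀ i, |D i 0| = 0 := fun i => by simp [h0']
  fin_cases i <;> fin_cases j <;> first | exact hd _ | exact hz _ | exact hz' _ | skip
  all_goals simp only [Fin.mk_one, Fin.reduceFinMk]; linarith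

/-- No vector of the Gale diagram is zero. -/
theorem exists_ne (h : IsAntipodalForm D) (i : Fin 6) : ∃ j, D i j ≠ 0 := by
  obtain ⟨j, hj⟩ := (h.perm (Equiv.swap 0 i)).exists_ne_of_zero
  rw [Equiv.swap_apply_left] at hj
  exact ⟨_, hj⟩

/-- If `s` and `t` cover the indices where row `i` is positive, respectively negative, then the
two sides carry the same mass `P > 0`, and an entry of `s` and an entry of `t` together have
absolute value at most `P`. -/
theorem row_mass (h : IsAntipodalForm D) {i : Fin 6} {s t : Finset (Fin 6)} (hst : Disjoint s t)
    (hs : ∀ j ∈ s, 0 ≤ D i j) (ht : ∀ j ∈ t, D i j ≤ 0) (hc : ∀ j, D i j ≠ 0 → j ∈ s ∪ t) :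
    ∃ P, 0 < P ∧ ∑ j ∈ s, D i j = P ∧ ∑ j ∈ t, -D i j = P ∧
      ∀ j ∈ s, ∀ k ∈ t, D i j - D i k ≤ P := by
  have hsum : ∑ j ∈ s, D i j + ∑ j ∈ t, D i j = 0 := by
    rw [← Finset.sum_union hst, ← h.sum_eq_zero i]
    exact Finset.sum_subset (Finset.subset_univ _) fun j _ hj => by
      by_contra hne; exact hj (hc j hne)
  have habs : ∑ j, |D i j| = ∑ j ∈ s, D i j + ∑ j ∈ t, -D i j := by
    rw [← Finset.sum_subset (Finset.subset_univ (s ∪ t)), Finset.sum_union hst]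
    · congr 1
      · exact Finset.sum_congr rfl fun j hj => abs_of_nonneg (hs j hj)
      · exact Finset.sum_congr rfl fun j hj => abs_of_nonpos (ht j hj)
    · intro j _ hj
      by_contra hne
      exact hj (hc j (by simpa using hne))
  have hneg : ∑ j ∈ t, -D i j = ∑ j ∈ s, D i j := by
    rw [Finset.sum_neg_distrib]; linarith
  refine ⟨∑ j ∈ s, D i j, ?_, rfl, hneg, ?_⟩
  · obtain ⟨j, hj⟩ := h.exists_ne i
    have hpos : 0 < ∑ j, |D i j| :=
      Finset.sum_pos' (fun _ _ => abs_nonneg _) ⟨j, Finset.mem_univ _, abs_pos.2 hj⟩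
    linarith
  · intro j hj k hk
    have hjk : j ≠ k := fun e => Finset.disjoint_left.1 hst hj (e ▸ hk)
    have := h.bound i j k hjk
    rw [abs_of_nonneg (hs j hj), abs_of_nonpos (ht k hk)] at this
    linarith

theorem neg (h : IsAntipodalForm D) : IsAntipodalForm fun i j => -D i j where
  antisymm i j := by rw [h.antisymm i j]
  plucker i j k l := by linarith [h.plucker i j k l]
  sum_eq_zero i := by rw [Finset.sum_neg_distrib, h.sum_eq_zero, neg_zero]
  bound i j k hjk := by
    simp only [abs_neg]
    linarith [h.bound i k j hjk.symm]
  ne_zero := by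
    obtain ⟨i, j, hij⟩ := h.ne_zero
    exact ⟨i, j, neg_ne_zero.2 hij⟩

/-- The negative side of a circuit has at least two points: the points are in convex position. -/
theorem two_le_card (h : IsAntipodalForm D) {i : Fin 6} {s t : Finset (Fin 6)}
    (hst : Disjoint s t) (hs : ∀ j ∈ s, 0 ≤ D i j) (ht : ∀ j ∈ t, D i j ≤ 0)
    (hc : ∀ j, D i j ≠ 0 → j ∈ s ∪ t) : 2 ≤ t.card := by
  obtain ⟨P, hP, hsP, htP, hb⟩ := h.row_mass hst hs ht hc
  by_contra! hlt
  obtain ⟨k, rfl⟩ : ∃ k, t = {k} := by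
    rw [← Finset.card_eq_one]
    have : t.card ≠ 0 := by
      intro h0
      rw [Finset.card_eq_zero.1 h0] at htP
      simp at htP; linarith
    omega
  rw [Finset.sum_singleton] at htP
  have : ∑ j ∈ s, D i j ≤ 0 := Finset.sum_nonpos fun j hj => by
    linarith [hb j hj k (Finset.mem_singleton_self k)]
  linarith

/-- On a circuit with two points on the negative side, each coefficient of the positive side is at
most each of those two in absolute value. -/
theorem le_of_card_eq_two (h : IsAntipodalForm D) {i : Fin 6} {s t : Finset (Fin 6)}
    (hst : Disjoint s t) (hs : ∀ j ∈ s, 0 ≤ D i j) (ht : ∀ j ∈ t, D i j ≤ 0)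
    (hc : ∀ j, D i j ≠ 0 → j ∈ s ∪ t) (h2 : t.card = 2) {k : Fin 6} (hk : k ∈ t) :
    0 < -D i k ∧ ∀ j ∈ s, D i j ≤ -D i k := by
  obtain ⟨P, hP, hsP, htP, hb⟩ := h.row_mass hst hs ht hc
  obtain ⟨x, hx⟩ : ∃ x, t.erase k = {x} := by
    rw [← Finset.card_eq_one, Finset.card_erase_of_mem hk, h2]
  have hxt : x ∈ t := Finset.mem_of_mem_erase (hx ▸ Finset.mem_singleton_self x)
  rw [← Finset.add_sum_erase _ _ hk, hx, Finset.sum_singleton] at htP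
  have hle : ∀ j ∈ s, D i j ≤ -D i k := fun j hj => by linarith [hb j hj x hxt]
  refine ⟨?_, hle⟩
  by_contra! h0
  have : ∑ j ∈ s, D i j ≤ 0 := Finset.sum_nonpos fun j hj => (hle j hj).trans h0
  linarith

/-- No two vectors of a Gale diagram are parallel to a third one. -/
theorem eq_of_eq_zero (h : IsAntipodalForm D) {i j k : Fin 6} (hj : D i j = 0) (hk : D i k = 0)
    (hij : i ≠ j) (hik : i ≠ k) : j = k := by
  classical
  by_contra hjk
  set s := Finset.univ.filter fun m => 0 < D i m
  set t := Finset.univ.filter fun m => D i m < 0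
  have hst : Disjoint s t := by
    rw [Finset.disjoint_left]; intro m; simp only [s, t, Finset.mem_filter]; intro h1 h2
    linarith [h1.2, h2.2]
  have h1 : 2 ≤ t.card := h.two_le_card hst (fun m hm => (Finset.mem_filter.1 hm).2.le)
    (fun m hm => (Finset.mem_filter.1 hm).2.le) fun m hm => by
      rcases lt_or_gt_of_ne hm with h | h <;> simp [s, t, h]
  have h2 : 2 ≤ s.card := h.neg.two_le_card (i := i) hst.symm
    (fun m hm => by linarith [(Finset.mem_filter.1 hm).2])
    (fun m hm => by linarith [(Finset.mem_filter.1 hm).2]) fun m hm => by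
      rcases lt_or_gt_of_ne (neg_ne_zero.1 hm) with h | h <;> simp [s, t, h]
  have h3 : Disjoint (s ∪ t) {i, j, k} := by
    rw [Finset.disjoint_right]
    intro m hm
    simp only [Finset.mem_insert, Finset.mem_singleton] at hm
    rcases hm with rfl | rfl | rfl <;> simp [s, t, hj, hk, h.diag]
  have h4 := Finset.card_le_univ ((s ∪ t) ∪ {i, j, k})
  rw [Finset.card_union_of_disjoint h3, Finset.card_union_of_disjoint hst,
    Finset.card_eq_three.2 ⟨i, j, k, hij, hik, hjk, rfl⟩, Fintype.card_fin] at h4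
  omega

end IsAntipodalForm

/-! ### The tournament of a Gale diagram -/

/-- A choice of orientation of every pair `{i, j}` compatible with the sign of `D i j`, pairs with
`D i j = 0` being oriented arbitrarily: `T i j = 1` if `i` points to `j`, and `T i j = 0`
otherwise. -/
structure IsOrientation (T : Fin 6 → Fin 6 → ℕ) (D : Fin 6 → Fin 6 → ℝ) : Prop where
  irrefl : ∀ i, T i i = 0
  total : ∀ i j, i ≠ j → T i j + T j i = 1
  nonneg : ∀ i j, T i j = 1 → 0 ≤ D i j

/-- The six vectors of the Gale diagram are split into two triples `p` and `q` with sum zero, which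
alternate in the cyclic order `p 0, q 0, p 1, q 1, p 2, q 2` and each of which precedes the vector
three places later by a nonnegative angle if it belongs to `p`. -/
structure IsInterlacing (D : Fin 6 → Fin 6 → ℝ) (p q : Fin 3 → Fin 6) : Prop where
  bijective : Function.Bijective (Sum.elim p q)
  sum_left : ∀ k, D k (p 0) + D k (p 1) + D k (p 2) = 0
  sum_right : ∀ k, D k (q 0) + D k (q 1) + D k (q 2) = 0
  pos_left : ∀ i, 0 < D (p i) (p (i + 1))
  pos_right : ∀ i, 0 < D (q i) (q (i + 1))
  nonneg₁ : ∀ i, 0 ≤ D (p i) (q i)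
  nonneg₂ : ∀ i, 0 ≤ D (p i) (q (i + 1))
  nonneg₃ : ∀ i, 0 ≤ D (q (i + 2)) (p i)

namespace IsOrientation

variable {T : Fin 6 → Fin 6 → ℕ} {D : Fin 6 → Fin 6 → ℝ}

theorem perm (o : IsOrientation T D) (σ : Equiv.Perm (Fin 6)) :
    IsOrientation (fun i j => T (σ i) (σ j)) fun i j => D (σ i) (σ j) where
  irrefl _ := o.irrefl _
  total _ _ hij := o.total _ _ (σ.injective.ne hij)
  nonneg _ _ := o.nonneg _ _

theorem le_one (o : IsOrientation T D) (i j : Fin 6) : T i j ≤ 1 := by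
  by_cases h : i = j
  · rw [h, o.irrefl]; exact zero_le_one
  · have := o.total i j h; omega

theorem ne_of_eq_one (o : IsOrientation T D) {i j : Fin 6} (h : T i j = 1) : i ≠ j := by
  rintro rfl
  rw [o.irrefl] at h
  exact zero_ne_one h

theorem eq_one_of_pos (h : IsAntipodalForm D) (o : IsOrientation T D) {i j : Fin 6}
    (hij : 0 < D i j) : T i j = 1 := by
  have hne : i ≠ j := by rintro rfl; rw [h.diag] at hij; exact lt_irrefl _ hij
  have h1 := o.total i j hne
  by_contra h2
  have h3 := o.nonneg j i (by omega)
  rw [h.antisymm] at h3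
  linarith

/-- The out-neighbours and the in-neighbours of `i` satisfy the hypotheses of
`IsAntipodalForm.row_mass`. -/
theorem neighbours (h : IsAntipodalForm D) (o : IsOrientation T D) (i : Fin 6) :
    Disjoint (Finset.univ.filter fun j => T i j = 1) (Finset.univ.filter fun j => T j i = 1) ∧
    (∀ j ∈ Finset.univ.filter fun j => T i j = 1, 0 ≤ D i j) ∧
    (∀ j ∈ Finset.univ.filter fun j => T j i = 1, D i j ≤ 0) ∧
    ∀ j, D i j ≠ 0 → j ∈ (Finset.univ.filter fun j => T i j = 1) ∪
      Finset.univ.filter fun j => T j i = 1 := by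
  refine ⟨?_, ?_, ?_, ?_⟩
  · rw [Finset.disjoint_left]
    intro j hj hj'
    rw [Finset.mem_filter] at hj hj'
    have := o.total i j (o.ne_of_eq_one hj.2)
    omega
  · intro j hj
    exact o.nonneg i j (Finset.mem_filter.1 hj).2
  · intro j hj
    have := o.nonneg j i (Finset.mem_filter.1 hj).2
    rw [h.antisymm] at this
    linarith
  · intro j hj
    have hne : i ≠ j := by rintro rfl; exact hj (h.diag _)
    have := o.total i j hne
    simp only [Finset.mem_union, Finset.mem_filter, Finset.mem_univ, true_and]
    omega

theorem card_out (o : IsOrientation T D) (i : Fin 6) :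
    (Finset.univ.filter fun j => T i j = 1).card = ∑ j, T i j := by
  rw [Finset.card_filter]
  refine Finset.sum_congr rfl fun j _ => ?_
  have := o.le_one i j
  split_ifs <;> omega

theorem card_in (o : IsOrientation T D) (i : Fin 6) :
    (Finset.univ.filter fun j => T j i = 1).card = ∑ j, T j i := by
  rw [Finset.card_filter]
  refine Finset.sum_congr rfl fun j _ => ?_
  have := o.le_one j i
  split_ifs <;> omega

theorem out_add_in (o : IsOrientation T D) (i : Fin 6) : ∑ j, T i j + ∑ j, T j i = 5 := by
  rw [← Finset.sum_add_distrib, ← Finset.add_sum_erase _ _ (Finset.mem_univ i), o.irrefl,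
    Finset.sum_congr rfl fun j hj => o.total i j (Finset.ne_of_mem_erase hj).symm]
  simp

theorem outdegree (h : IsAntipodalForm D) (o : IsOrientation T D) (i : Fin 6) :
    ∑ j, T i j = 2 ∨ ∑ j, T i j = 3 := by
  obtain ⟨h1, h2, h3, h4⟩ := o.neighbours h i
  have hin := h.two_le_card h1 h2 h3 h4
  have hout := h.neg.two_le_card (i := i) h1.symm (fun j hj => neg_nonneg.2 (h3 j hj))
    (fun j hj => neg_nonpos.2 (h2 j hj)) fun j hj => by
      rw [Finset.union_comm]; exact h4 j (neg_ne_zero.1 hj)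
  rw [o.card_in] at hin
  rw [o.card_out] at hout
  have := o.out_add_in i
  omega

theorem le_of_three (h : IsAntipodalForm D) (o : IsOrientation T D) {i : Fin 6}
    (hi : ∑ j, T i j = 3) {k : Fin 6} (hk : T k i = 1) :
    0 < D k i ∧ ∀ j, T i j = 1 → D i j ≤ D k i := by
  obtain ⟨h1, h2, h3, h4⟩ := o.neighbours h i
  have h5 := o.out_add_in i
  obtain ⟨h6, h7⟩ := h.le_of_card_eq_two h1 h2 h3 h4 (by rw [o.card_in]; omega)
    (k := k) (by simpa using hk)
  rw [h.antisymm k i]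
  exact ⟨h6, fun j hj => h7 j (by simpa using hj)⟩

theorem le_of_two (h : IsAntipodalForm D) (o : IsOrientation T D) {i : Fin 6}
    (hi : ∑ j, T i j = 2) {j : Fin 6} (hj : T i j = 1) :
    0 < D i j ∧ ∀ k, T k i = 1 → D k i ≤ D i j := by
  obtain ⟨h1, h2, h3, h4⟩ := o.neighbours h i
  obtain ⟨h6, h7⟩ := h.neg.le_of_card_eq_two (i := i) h1.symm
    (fun j hj => neg_nonneg.2 (h3 j hj)) (fun j hj => neg_nonpos.2 (h2 j hj))
    (fun j hj => by rw [Finset.union_comm]; exact h4 j (neg_ne_zero.1 hj))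
    (by rw [o.card_out]; omega) (k := j) (by simpa using hj)
  rw [neg_neg] at h6 h7
  refine ⟨h6, fun k hk => ?_⟩
  have := h7 k (by simpa using hk)
  rwa [← h.antisymm] at this

/-- Three vectors have outdegree three, and three have outdegree two. -/
theorem card_three (h : IsAntipodalForm D) (o : IsOrientation T D) :
    (Finset.univ.filter fun i => ∑ j, T i j = 3).card = 3 := by
  have h1 : ∑ i, ∑ j, T i j + ∑ i, ∑ j, T j i = 30 := by
    rw [← Finset.sum_add_distrib, Finset.sum_congr rfl fun i _ => o.out_add_in i]
    simp
  rw [Finset.sum_comm (f := fun i j => T j i)] at h1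
  have h2 : ∑ i, ∑ j, T i j = ∑ i, (2 + if ∑ j, T i j = 3 then 1 else 0) := by
    refine Finset.sum_congr rfl fun i _ => ?_
    rcases o.outdegree h i with hi | hi <;> simp [hi]
  rw [Finset.sum_add_distrib, ← Finset.card_filter] at h2
  simp only [Finset.sum_const, Finset.card_univ, Fintype.card_fin, smul_eq_mul] at h2
  omega

end IsOrientation

theorem IsInterlacing.of_perm {D : Fin 6 → Fin 6 → ℝ} {p q : Fin 3 → Fin 6}
    {σ : Equiv.Perm (Fin 6)} (h : IsInterlacing (fun i j => D (σ i) (σ j)) p q) :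
    IsInterlacing D (σ ∘ p) (σ ∘ q) where
  bijective := by
    rw [← Sum.comp_elim]; exact σ.bijective.comp h.bijective
  sum_left k := by simpa using h.sum_left (σ.symm k)
  sum_right k := by simpa using h.sum_right (σ.symm k)
  pos_left := h.pos_left
  pos_right := h.pos_right
  nonneg₁ := h.nonneg₁
  nonneg₂ := h.nonneg₂
  nonneg₃ := h.nonneg₃

namespace IsAntipodalForm

variable {T : Fin 6 → Fin 6 → ℕ} {D : Fin 6 → Fin 6 → ℝ}

/-- Three vectors of the plane with equal cyclic determinants have sum zero. -/
theorem sum_eq_zero_of_cyclic (h : IsAntipodalForm D) {x y z : Fin 6} (h1 : D x y = D y z)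
    (h2 : D x y = D z x) (hpos : D x y ≠ 0) (k : Fin 6) : D k x + D k y + D k z = 0 := by
  have hp := h.plucker x y z k
  have hzx := h.antisymm x z
  have hkx := h.antisymm k x
  have hky := h.antisymm k y
  have hkz := h.antisymm k z
  apply (mul_eq_zero.1 _).resolve_left hpos
  rw [hkx, hky, hkz]
  rw [hzx, ← h2, ← h1] at hp
  linarith

theorem cyclic_of_sum_eq_zero (h : IsAntipodalForm D) {x y z : Fin 6}
    (hs : ∀ k, D k x + D k y + D k z = 0) : D x y = D y z ∧ D x y = D z x := by
  have h1 := hs x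
  have h2 := hs y
  have h3 := hs z
  rw [h.diag] at h1 h2 h3
  have := h.antisymm x y
  have := h.antisymm y z
  have := h.antisymm x z
  constructor <;> linarith

theorem sum_six (h : IsAntipodalForm D) (k : Fin 6) :
    D k 0 + D k 1 + D k 2 + (D k 3 + D k 4 + D k 5) = 0 := by
  have := h.sum_eq_zero k
  rw [Fin.sum_univ_six] at this
  linarith

theorem isInterlacing_of_pos (h : IsAntipodalForm D) {p0 p1 p2 q0 q1 q2 : Fin 6}
    (hb : Function.Bijective (Sum.elim ![p0, p1, p2] ![q0, q1, q2]))
    (hsp : ∀ k, D k p0 + D k p1 + D k p2 = 0) (hsq : ∀ k, D k q0 + D k q1 + D k q2 = 0)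
    (hp : 0 < D p0 p1) (hq : 0 < D q0 q1)
    (h00 : 0 ≤ D p0 q0) (h11 : 0 ≤ D p1 q1) (h22 : 0 ≤ D p2 q2)
    (h01 : 0 ≤ D p0 q1) (h12 : 0 ≤ D p1 q2) (h20 : 0 ≤ D p2 q0)
    (k20 : 0 ≤ D q2 p0) (k01 : 0 ≤ D q0 p1) (k12 : 0 ≤ D q1 p2) :
    IsInterlacing D ![p0, p1, p2] ![q0, q1, q2] := by
  obtain ⟨hp1, hp2⟩ := h.cyclic_of_sum_eq_zero hsp
  obtain ⟨hq1, hq2⟩ := h.cyclic_of_sum_eq_zero hsq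
  refine ⟨hb, hsp, hsq, ?_, ?_, ?_, ?_, ?_⟩ <;> intro i <;> fin_cases i
  exacts [hp, hp1 ▸ hp, hp2 ▸ hp, hq, hq1 ▸ hq, hq2 ▸ hq, h00, h11, h22, h01, h12, h20,
    k20, k01, k12]

theorem exists_isInterlacing_of_pos (h : IsAntipodalForm D) (o : IsOrientation T D)
    (h0 : ∑ j, T 0 j = 3) (h1 : ∑ j, T 1 j = 3) (h2 : ∑ j, T 2 j = 3)
    (h3 : ∑ j, T 3 j = 2) (h4 : ∑ j, T 4 j = 2) (h5 : ∑ j, T 5 j = 2)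
    (hs : ∀ k, D k 0 + D k 1 + D k 2 = 0) (hp : 0 < D 0 1) (hq : 0 < D 3 4) :
    ∃ p q, IsInterlacing D p q := by
  have hs' : ∀ k, D k 3 + D k 4 + D k 5 = 0 := fun k => by linarith [hs k, h.sum_six k]
  obtain ⟨hp1, hp2⟩ := h.cyclic_of_sum_eq_zero hs
  obtain ⟨hq1, hq2⟩ := h.cyclic_of_sum_eq_zero hs'
  have t01 := o.eq_one_of_pos h hp
  have t12 := o.eq_one_of_pos h (hp1 ▸ hp)
  have t20 := o.eq_one_of_pos h (hp2 ▸ hp)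
  have t34 := o.eq_one_of_pos h hq
  have t45 := o.eq_one_of_pos h (hq1 ▸ hq)
  have t53 := o.eq_one_of_pos h (hq2 ▸ hq)
  rw [Fin.sum_univ_six, o.irrefl] at h0 h1 h2 h3 h4 h5
  have o01 := o.total 0 1 (by decide)
  have o12 := o.total 1 2 (by decide)
  have o20 := o.total 2 0 (by decide)
  have o34 := o.total 3 4 (by decide)
  have o45 := o.total 4 5 (by decide)
  have o53 := o.total 5 3 (by decide)
  have o03 := o.total 0 3 (by decide)
  have o04 := o.total 0 4 (by decide)
  have o05 := o.total 0 5 (by decide)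
  have o13 := o.total 1 3 (by decide)
  have o14 := o.total 1 4 (by decide)
  have o15 := o.total 1 5 (by decide)
  have o23 := o.total 2 3 (by decide)
  have o24 := o.total 2 4 (by decide)
  have o25 := o.total 2 5 (by decide)
  have r0 : T 0 3 + T 0 4 + T 0 5 = 2 := by omega
  have r1 : T 1 3 + T 1 4 + T 1 5 = 2 := by omega
  have r2 : T 2 3 + T 2 4 + T 2 5 = 2 := by omega
  have r3 : T 3 0 + T 3 1 + T 3 2 = 1 := by omega
  have r4 : T 4 0 + T 4 1 + T 4 2 = 1 := by omega
  have r5 : T 5 0 + T 5 1 + T 5 2 = 1 := by omega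
  clear h0 h1 h2 h3 h4 h5 o01 o12 o20 o34 o45 o53 t01 t12 t20 t34 t45 t53
  -- Every vector of the first triple has one in-neighbour in the second, and this matches the two
  -- triples. The three matchings that reverse the cyclic order contradict a Plücker relation.
  have key : ∀ x y : Fin 6, 0 < D x y → T x 0 = 1 → T 1 x = 1 → T 0 y = 1 → T 1 y = 1 →
      False := by
    intro x y hxy hx0 h1x h0y h1y
    have e1 := mul_pos hp hxy
    have e2 := mul_nonneg (o.nonneg _ _ hx0) (o.nonneg _ _ h1y)
    have e3 := mul_nonneg (o.nonneg _ _ h0y) (o.nonneg _ _ h1x)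
    have e4 := h.plucker 0 1 x y
    rw [h.antisymm 0 x] at e4
    linarith
  rcases (by omega : T 3 0 = 1 ∨ T 4 0 = 1 ∨ T 5 0 = 1) with m0 | m0 | m0
  · rcases (by omega : T 4 1 = 1 ∨ T 5 1 = 1) with m1 | m1
    · have m2 : T 5 2 = 1 := by omega
      exact ⟨_, _, h.isInterlacing_of_pos (p0 := 0) (p1 := 1) (p2 := 2) (q0 := 4) (q1 := 5)
        (q2 := 3) (by decide) hs (fun k => by linarith [hs' k]) hp (hq1 ▸ hq)
        (o.nonneg _ _ (by omega)) (o.nonneg _ _ (by omega)) (o.nonneg _ _ (by omega))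
        (o.nonneg _ _ (by omega)) (o.nonneg _ _ (by omega)) (o.nonneg _ _ (by omega))
        (o.nonneg _ _ (by omega)) (o.nonneg _ _ (by omega)) (o.nonneg _ _ (by omega))⟩
    · exact (key 3 4 hq m0 (by omega) (by omega) (by omega)).elim
  · rcases (by omega : T 5 1 = 1 ∨ T 3 1 = 1) with m1 | m1
    · have m2 : T 3 2 = 1 := by omega
      exact ⟨_, _, h.isInterlacing_of_pos (p0 := 0) (p1 := 1) (p2 := 2) (q0 := 5) (q1 := 3)
        (q2 := 4) (by decide) hs (fun k => by linarith [hs' k]) hp (hq2 ▸ hq)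
        (o.nonneg _ _ (by omega)) (o.nonneg _ _ (by omega)) (o.nonneg _ _ (by omega))
        (o.nonneg _ _ (by omega)) (o.nonneg _ _ (by omega)) (o.nonneg _ _ (by omega))
        (o.nonneg _ _ (by omega)) (o.nonneg _ _ (by omega)) (o.nonneg _ _ (by omega))⟩
    · exact (key 4 5 (hq1 ▸ hq) m0 (by omega) (by omega) (by omega)).elim
  · rcases (by omega : T 3 1 = 1 ∨ T 4 1 = 1) with m1 | m1
    · have m2 : T 4 2 = 1 := by omega
      exact ⟨_, _, h.isInterlacing_of_pos (p0 := 0) (p1 := 1) (p2 := 2) (q0 := 3) (q1 := 4)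
        (q2 := 5) (by decide) hs hs' hp hq
        (o.nonneg _ _ (by omega)) (o.nonneg _ _ (by omega)) (o.nonneg _ _ (by omega))
        (o.nonneg _ _ (by omega)) (o.nonneg _ _ (by omega)) (o.nonneg _ _ (by omega))
        (o.nonneg _ _ (by omega)) (o.nonneg _ _ (by omega)) (o.nonneg _ _ (by omega))⟩
    · exact (key 5 3 (hq2 ▸ hq) m0 (by omega) (by omega) (by omega)).elim

/-- If the three vectors of outdegree three form a directed cycle, the comparison of coefficients
along the cycle makes their determinants equal, so that they have sum zero. -/
theorem exists_isInterlacing_of_cyclic (h : IsAntipodalForm D) (o : IsOrientation T D)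
    (h0 : ∑ j, T 0 j = 3) (h1 : ∑ j, T 1 j = 3) (h2 : ∑ j, T 2 j = 3)
    (h3 : ∑ j, T 3 j = 2) (h4 : ∑ j, T 4 j = 2) (h5 : ∑ j, T 5 j = 2)
    (t01 : T 0 1 = 1) (t12 : T 1 2 = 1) (t20 : T 2 0 = 1) :
    ∃ p q, IsInterlacing D p q := by
  have e0 := (o.le_of_three h h0 t20).2 1 t01
  have e1 := (o.le_of_three h h1 t01).2 2 t12
  have e2 := (o.le_of_three h h2 t12).2 0 t20
  have hp := (o.le_of_three h h1 t01).1
  have hs := h.sum_eq_zero_of_cyclic (x := 0) (y := 1) (z := 2) (by linarith) (by linarith) hp.ne'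
  have hs' : ∀ k, D k 3 + D k 4 + D k 5 = 0 := fun k => by linarith [hs k, h.sum_six k]
  have hq := (h.cyclic_of_sum_eq_zero hs').2
  rcases lt_trichotomy (D 3 4) 0 with hneg | hzero | hpos
  · have hσ : ∀ i, (∑ j, T i ((Equiv.swap (4 : Fin 6) 5) j)) = ∑ j, T i j := fun i =>
      Equiv.sum_comp _ _
    obtain ⟨p, q, hpq⟩ := (h.perm (Equiv.swap 4 5)).exists_isInterlacing_of_pos
      (o.perm (Equiv.swap 4 5)) ((hσ _).trans h0) ((hσ _).trans h1) ((hσ _).trans h2)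
      ((hσ _).trans h3) ((hσ _).trans h5) ((hσ _).trans h4) (fun k => hs _) hp
      (by
        change 0 < D 3 5
        rw [h.antisymm]; linarith)
    exact ⟨_, _, hpq.of_perm⟩
  · have : D 3 5 = 0 := by rw [h.antisymm]; linarith
    exact absurd (h.eq_of_eq_zero hzero this (by decide) (by decide)) (by decide)
  · exact h.exists_isInterlacing_of_pos o h0 h1 h2 h3 h4 h5 hs hp hpos

/-- If the vectors of outdegree three do not form a directed cycle, neither do those of outdegree
two. -/
theorem false_of_cyclic_of_transitive (h : IsAntipodalForm D) (o : IsOrientation T D)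
    (h3 : ∑ j, T 3 j = 2) (h4 : ∑ j, T 4 j = 2) (h5 : ∑ j, T 5 j = 2)
    (t01 : T 0 1 = 1) (t02 : T 0 2 = 1)
    (t34 : T 3 4 = 1) (t45 : T 4 5 = 1) (t53 : T 5 3 = 1) : False := by
  have e3 := (o.le_of_two h h3 t34).2 5 t53
  have e4 := (o.le_of_two h h4 t45).2 3 t34
  have e5 := (o.le_of_two h h5 t53).2 4 t45
  have hq := (o.le_of_two h h3 t34).1
  have hs' := h.sum_eq_zero_of_cyclic (x := 3) (y := 4) (z := 5) (by linarith) (by linarith) hq.ne'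
  have hs : ∀ k, D k 0 + D k 1 + D k 2 = 0 := fun k => by linarith [hs' k, h.sum_six k]
  have hp := (h.cyclic_of_sum_eq_zero hs).2
  have h1 := o.nonneg 0 1 t01
  have h2 := o.nonneg 0 2 t02
  rw [h.antisymm 2 0] at hp
  exact absurd (h.eq_of_eq_zero (i := 0) (j := 1) (k := 2) (by linarith) (by linarith)
    (by decide) (by decide)) (by decide)

/-- If both triples of equal outdegree are transitively oriented, the orientation is determined,
and a Plücker relation forces `D 1 4 = 0`. After reversing the orientation of this pair, the
vectors `0, 2, 4` of outdegree three form a directed cycle. -/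
theorem exists_isInterlacing_of_transitive (h : IsAntipodalForm D) (o : IsOrientation T D)
    (h0 : ∑ j, T 0 j = 3) (h1 : ∑ j, T 1 j = 3) (h2 : ∑ j, T 2 j = 3)
    (h3 : ∑ j, T 3 j = 2) (h4 : ∑ j, T 4 j = 2) (h5 : ∑ j, T 5 j = 2)
    (t01 : T 0 1 = 1) (t12 : T 1 2 = 1) (t02 : T 0 2 = 1)
    (t34 : T 3 4 = 1) (t45 : T 4 5 = 1) (t35 : T 3 5 = 1) :
    ∃ p q, IsInterlacing D p q := by
  have h0' := h0
  have h1' := h1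
  have h2' := h2
  have h3' := h3
  have h4' := h4
  have h5' := h5
  rw [Fin.sum_univ_six, o.irrefl] at h0' h1' h2' h3' h4' h5'
  have o01 := o.total 0 1 (by decide)
  have o12 := o.total 1 2 (by decide)
  have o02 := o.total 0 2 (by decide)
  have o34 := o.total 3 4 (by decide)
  have o45 := o.total 4 5 (by decide)
  have o35 := o.total 3 5 (by decide)
  have o03 := o.total 0 3 (by decide)
  have o04 := o.total 0 4 (by decide)
  have o05 := o.total 0 5 (by decide)
  have o13 := o.total 1 3 (by decide)
  have o14 := o.total 1 4 (by decide)
  have o15 := o.total 1 5 (by decide)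
  have o23 := o.total 2 3 (by decide)
  have o24 := o.total 2 4 (by decide)
  have o25 := o.total 2 5 (by decide)
  have t23 : T 2 3 = 1 := by omega
  have t24 : T 2 4 = 1 := by omega
  have t25 : T 2 5 = 1 := by omega
  have t03 : T 0 3 = 1 := by omega
  have t13 : T 1 3 = 1 := by omega
  have t40 : T 4 0 = 1 := by omega
  have t50 : T 5 0 = 1 := by omega
  have t51 : T 5 1 = 1 := by omega
  have t14 : T 1 4 = 1 := by omega
  have hz : D 1 4 = 0 := by
    have e1 := mul_le_mul ((o.le_of_three h h0 t40).2 1 t01) ((o.le_of_two h h5 t51).2 4 t45)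
      (o.nonneg _ _ t45) (o.nonneg _ _ t40)
    have e2 := h.plucker 0 1 4 5
    have e3 := (o.le_of_three h h0 t50).1
    rw [h.antisymm 0 4, h.antisymm 0 5, h.antisymm 1 5] at e2
    have e4 : D 5 0 * D 1 4 ≤ 0 := by linarith
    exact le_antisymm (nonpos_of_mul_nonpos_right e4 e3) (o.nonneg _ _ t14)
  have e1 := (o.le_of_three h h0 t40).2 2 t02
  have e2 := (o.le_of_three h h2 t02).2 4 t24
  have e3 : D 4 0 = D 2 4 := by
    have r := h.sum_six 4
    have a1 := (o.le_of_two h h4 t40).2 2 t24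
    have a2 := (o.le_of_two h h4 t40).2 3 t34
    have a3 := (o.le_of_two h h4 t45).2 2 t24
    have a4 := (o.le_of_two h h4 t45).2 3 t34
    rw [h.antisymm 4 1, h.antisymm 4 2, h.antisymm 4 3, h.diag] at r
    linarith
  have hp := (o.le_of_three h h2 t02).1
  have hs := h.sum_eq_zero_of_cyclic (x := 0) (y := 2) (z := 4) (by linarith) (by linarith) hp.ne'
  have hs' : ∀ k, D k 1 + D k 3 + D k 5 = 0 := fun k => by linarith [hs k, h.sum_six k]
  have hq : 0 < D 1 3 := by
    rw [(h.cyclic_of_sum_eq_zero hs').2]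
    exact (o.le_of_two h h5 t51).1
  exact ⟨_, _, h.isInterlacing_of_pos (p0 := 0) (p1 := 2) (p2 := 4) (q0 := 1) (q1 := 3)
    (q2 := 5) (by decide) hs hs' hp hq
    (o.nonneg _ _ t01) (o.nonneg _ _ t23) (o.nonneg _ _ t45)
    (o.nonneg _ _ t03) (o.nonneg _ _ t25) (by rw [h.antisymm, hz, neg_zero])
    (o.nonneg _ _ t50) (o.nonneg _ _ t12) (o.nonneg _ _ t34)⟩

end IsAntipodalForm

/-- Every tournament on three vertices is a directed cycle or transitive. -/
theorem IsOrientation.exists_labelling {T : Fin 6 → Fin 6 → ℕ} {D : Fin 6 → Fin 6 → ℝ}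
    (o : IsOrientation T D) {s : Finset (Fin 6)} (hs : s.card = 3) :
    ∃ x y z, s = {x, y, z} ∧ x ≠ y ∧ x ≠ z ∧ y ≠ z ∧
      T x y = 1 ∧ T y z = 1 ∧ (T x z = 1 ∨ T z x = 1) := by
  obtain ⟨x, y, z, hxy, hxz, hyz, rfl⟩ := Finset.card_eq_three.1 hs
  have h1 := o.total x y hxy
  have h2 := o.total x z hxz
  have h3 := o.total y z hyz
  by_cases a : T x y = 1
  · by_cases b : T y z = 1
    · exact ⟨x, y, z, rfl, hxy, hxz, hyz, a, b, by omega⟩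
    · by_cases c : T x z = 1
      · exact ⟨x, z, y, by grind, hxz, hxy, hyz.symm, c, by omega, by omega⟩
      · exact ⟨z, x, y, by grind, hxz.symm, hyz.symm, hxy, by omega, a, by omega⟩
  · by_cases b : T x z = 1
    · exact ⟨y, x, z, by grind, hxy.symm, hyz, hxz, by omega, b, by omega⟩
    · by_cases c : T y z = 1
      · exact ⟨y, z, x, by grind, hyz, hxy.symm, hxz.symm, c, by omega, by omega⟩
      · exact ⟨z, y, x, by grind, hyz.symm, hxz.symm, hxy.symm, by omega, by omega, by omega⟩

open Classical in
theorem IsAntipodalForm.exists_isOrientation {D : Fin 6 → Fin 6 → ℝ} (h : IsAntipodalForm D) :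
    ∃ T, IsOrientation T D := by
  refine ⟨fun i j => if 0 < D i j ∨ (D i j = 0 ∧ i < j) then 1 else 0, ?_, ?_, ?_⟩
  · intro i
    simp [h.diag]
  · intro i j hij
    have := h.antisymm j i
    rcases lt_trichotomy (D i j) 0 with h1 | h1 | h1
    · have h2 : 0 < D j i := by linarith
      simp [h2, h1.not_gt, h1.ne]
    · have h2 : D j i = 0 := by linarith
      rcases lt_or_gt_of_ne hij with h3 | h3 <;> simp [h1, h2, h3, h3.not_gt]
    · have h2 : ¬ 0 < D j i := by linarith
      have h3 : D j i ≠ 0 := by linarith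
      simp [h1, h2, h3]
  · intro i j hij
    by_contra! hlt
    simp [hlt.not_gt, hlt.ne] at hij

theorem IsAntipodalForm.exists_isInterlacing {D : Fin 6 → Fin 6 → ℝ} (h : IsAntipodalForm D) :
    ∃ p q, IsInterlacing D p q := by
  obtain ⟨T, o⟩ := h.exists_isOrientation
  set s := Finset.univ.filter fun i => ∑ j, T i j = 3 with hs
  have h3 := o.card_three h
  rw [← hs] at h3
  obtain ⟨x, y, z, hxyz, hxy, hxz, hyz, txy, tyz, txz⟩ := o.exists_labelling h3
  have h3' : sᶜ.card = 3 := by rw [Finset.card_compl, h3]; rfl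
  obtain ⟨x', y', z', hxyz', hxy', hxz', hyz', txy', tyz', txz'⟩ := o.exists_labelling h3'
  have hmem : ∀ i ∈ s, ∑ j, T i j = 3 := fun i hi => (Finset.mem_filter.1 hi).2
  have hmem' : ∀ i ∈ sᶜ, ∑ j, T i j = 2 := fun i hi => by
    have := o.outdegree h i
    simp only [hs, Finset.mem_compl, Finset.mem_filter, Finset.mem_univ, true_and] at hi
    tauto
  have hne : ∀ i ∈ s, ∀ j ∈ sᶜ, i ≠ j := fun i hi j hj e => Finset.mem_compl.1 hj (e ▸ hi)
  have hinj : Function.Injective ![x, y, z, x', y', z'] := by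
    rw [hxyz', hxyz] at hne
    simp only [Finset.mem_insert, Finset.mem_singleton, forall_eq_or_imp, forall_eq] at hne
    intro i j hij
    fin_cases i <;> fin_cases j <;> simp at hij ⊢ <;> grind
  set σ : Equiv.Perm (Fin 6) := Equiv.ofBijective _ (Finite.injective_iff_bijective.1 hinj)
  have hσ : ∀ i, (∑ j, T i (σ j)) = ∑ j, T i j := fun i => Equiv.sum_comp _ _
  have h0 := (hσ x).trans (hmem x (by simp [hxyz]))
  have h1 := (hσ y).trans (hmem y (by simp [hxyz]))
  have h2 := (hσ z).trans (hmem z (by simp [hxyz]))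
  have h3 := (hσ x').trans (hmem' x' (by simp [hxyz']))
  have h4 := (hσ y').trans (hmem' y' (by simp [hxyz']))
  have h5 := (hσ z').trans (hmem' z' (by simp [hxyz']))
  suffices ∃ p q, IsInterlacing (fun i j => D (σ i) (σ j)) p q by
    obtain ⟨p, q, hpq⟩ := this
    exact ⟨_, _, hpq.of_perm⟩
  rcases txz with txz | txz
  · rcases txz' with txz' | txz'
    · exact (h.perm σ).exists_isInterlacing_of_transitive (o.perm σ) h0 h1 h2 h3 h4 h5 txy tyz txz
        txy' tyz' txz'
    · exact ((h.perm σ).false_of_cyclic_of_transitive (o.perm σ) h3 h4 h5 txy txz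
        txy' tyz' txz').elim
  · exact (h.perm σ).exists_isInterlacing_of_cyclic (o.perm σ) h0 h1 h2 h3 h4 h5 txy tyz txz

/-! ### Equidistant points and their Gale diagram -/

section

variable {E : Type*} [NormedAddCommGroup E] [NormedSpace ℝ E]

/-- The coefficients of an affine dependence of equidistant points: two points on opposite sides
carry at most half of the total mass. The proof evaluates the dependence at a norming functional of
`x j - x k`, which is maximal at `x j` and minimal at `x k` among the points. -/
theorem dependence_bound {ι : Type*} [Fintype ι] {x : ι → E} {l : ℝ} (hl : 0 < l)
    (hx : ∀ i j, i ≠ j → ‖x i - x j‖ = l) {c : ι → ℝ} (hc : ∑ i, c i = 0)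
    (hcx : ∑ i, c i • x i = 0) {j k : ι} (hjk : j ≠ k) :
    c j - c k + |c j| + |c k| ≤ ∑ i, |c i| := by
  classical
  have hne : x j - x k ≠ 0 := by
    intro h0
    have := hx j k hjk
    rw [h0, norm_zero] at this
    exact hl.ne this
  obtain ⟨g, hg, hgx⟩ := exists_dual_vector ℝ _ (norm_ne_zero_iff.2 hne)
  simp only [RCLike.ofReal_real_eq_id, id, hx j k hjk, map_sub] at hgx
  have hle : ∀ i m, g (x i) - g (x m) ≤ l := by
    intro i m
    rcases eq_or_ne i m with rfl | him
    · simpa using hl.le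
    · rw [← map_sub, ← hx i m him]
      calc g (x i - x m) ≤ ‖g (x i - x m)‖ := le_abs_self _
        _ ≤ ‖g‖ * ‖x i - x m‖ := g.le_opNorm _
        _ = ‖x i - x m‖ := by rw [hg, one_mul]
  set t : ι → ℝ := fun i => g (x i) - g (x j) + l / 2 with ht
  have htj : t j = l / 2 := by simp [ht]
  have htk : t k = -(l / 2) := by simp only [ht]; linarith
  have habs : ∀ i, |t i| ≤ l / 2 := fun i => by
    rw [abs_le]
    constructor <;> simp only [ht] <;> linarith [hle j i, hle i k, hle i j]
  have hsum : ∑ i, c i * t i = 0 := by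
    have h1 := congrArg g hcx
    simp only [map_sum, map_smul, smul_eq_mul, map_zero] at h1
    have h2 : ∀ i, c i * t i = c i * g (x i) + c i * (l / 2 - g (x j)) := fun i => by
      simp only [ht]; ring
    rw [Finset.sum_congr rfl fun i _ => h2 i, Finset.sum_add_distrib, h1, ← Finset.sum_mul, hc]
    ring
  have hkj : k ∈ Finset.univ.erase j := Finset.mem_erase.2 ⟨hjk.symm, Finset.mem_univ _⟩
  rw [← Finset.add_sum_erase _ _ (Finset.mem_univ j), ← Finset.add_sum_erase _ _ hkj, htj, htk]
    at hsum
  rw [← Finset.add_sum_erase _ _ (Finset.mem_univ j), ← Finset.add_sum_erase _ _ hkj]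
  have hrest : -(∑ i ∈ (Finset.univ.erase j).erase k, c i * t i) ≤
      (∑ i ∈ (Finset.univ.erase j).erase k, |c i|) * (l / 2) := by
    rw [← Finset.sum_neg_distrib, Finset.sum_mul]
    refine Finset.sum_le_sum fun i _ => ?_
    calc -(c i * t i) ≤ |c i * t i| := neg_le_abs _
      _ = |c i| * |t i| := abs_mul _ _
      _ ≤ |c i| * (l / 2) := mul_le_mul_of_nonneg_left (habs i) (abs_nonneg _)
  have : (c j - c k) * (l / 2) ≤
      (∑ i ∈ (Finset.univ.erase j).erase k, |c i|) * (l / 2) := by linarith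
  have := le_of_mul_le_mul_right this (by linarith)
  linarith

/-- The map whose kernel is the space of affine dependences of the points `x i`. -/
def affineCombination {ι : Type*} [Fintype ι] (x : ι → E) : (ι → ℝ) →ₗ[ℝ] E × ℝ :=
  (Fintype.linearCombination ℝ x).prod (Fintype.linearCombination ℝ fun _ => (1 : ℝ))

theorem mem_ker_affineCombination {ι : Type*} [Fintype ι] {x : ι → E} {c : ι → ℝ} :
    c ∈ LinearMap.ker (affineCombination x) ↔ ∑ i, c i • x i = 0 ∧ ∑ i, c i = 0 := by
  simp [affineCombination, Fintype.linearCombination_apply]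

/-- Two independent affine dependences of six equidistant points define a Gale diagram, which is
antipodal. -/
theorem isAntipodalForm_of_dependences {x : Fin 6 → E} {l : ℝ} (hl : 0 < l)
    (hx : ∀ i j, i ≠ j → ‖x i - x j‖ = l) {u v : Fin 6 → ℝ}
    (hu : u ∈ LinearMap.ker (affineCombination x)) (hv : v ∈ LinearMap.ker (affineCombination x))
    (huv : LinearIndependent ℝ ![u, v]) : IsAntipodalForm fun i j => u i * v j - u j * v i := by
  have hker : ∀ i, (fun j => u i * v j - u j * v i) ∈ LinearMap.ker (affineCombination x) := by
    intro i
    have := Submodule.sub_mem _ (Submodule.smul_mem _ (u i) hv) (Submodule.smul_mem _ (v i) hu)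
    convert this using 1
    ext j
    simp [mul_comm]
  refine ⟨fun i j => by ring, fun i j k m => by ring,
    fun i => (mem_ker_affineCombination.1 (hker i)).2, fun i j k hjk => ?_, ?_⟩
  · obtain ⟨h1, h2⟩ := mem_ker_affineCombination.1 (hker i)
    exact dependence_bound hl hx h2 h1 hjk
  · by_contra! h0
    rw [LinearIndependent.pair_iff] at huv
    have hu0 : ∀ i, u i = 0 := fun i => by
      have := (huv (-v i) (u i) (by ext j; simpa [mul_comm] using by linarith [h0 i j])).2
      exact this
    have := (huv 1 0 (by ext j; simp [hu0])).1
    exact one_ne_zero this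

theorem exists_linearIndependent_pair_of_two_le {V : Type*} [AddCommGroup V] [Module ℝ V]
    {K : Submodule ℝ V} (hK : 2 ≤ Module.finrank ℝ K) :
    ∃ u ∈ K, ∃ v ∈ K, LinearIndependent ℝ ![u, v] := by
  have hfin : Module.Finite ℝ K := Module.finite_of_finrank_pos (by omega)
  have : Nontrivial K := Module.nontrivial_of_finrank_pos (R := ℝ) (by omega)
  obtain ⟨u, hu⟩ := exists_ne (0 : K)
  obtain ⟨v, hv⟩ := exists_linearIndependent_pair_of_one_lt_finrank (R := ℝ) (by omega) hu
  exact ⟨u, u.2, v, v.2, LinearIndependent.pair_iff.2 fun s t hst =>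
    LinearIndependent.pair_iff.1 hv s t (Subtype.ext hst)⟩

/-- The affine dependences of six equidistant points form a space of dimension at most two:
otherwise a two-dimensional subspace of them vanishes at one point. -/
theorem finrank_ker_affineCombination_le {x : Fin 6 → E} {l : ℝ} (hl : 0 < l)
    (hx : ∀ i j, i ≠ j → ‖x i - x j‖ = l) :
    Module.finrank ℝ (LinearMap.ker (affineCombination x)) ≤ 2 := by
  by_contra! h3
  set K := LinearMap.ker (affineCombination x)
  set π : K →ₗ[ℝ] ℝ := (LinearMap.proj 0).comp K.subtype with hπ
  have h1 := LinearMap.finrank_range_add_finrank_ker π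
  have h2 : Module.finrank ℝ (LinearMap.range π) ≤ 1 := by
    simpa using Submodule.finrank_le (LinearMap.range π)
  obtain ⟨u, hu, v, hv, huv⟩ :=
    exists_linearIndependent_pair_of_two_le (K := LinearMap.ker π) (by omega)
  have huv' : LinearIndependent ℝ ![(u : Fin 6 → ℝ), v] :=
    LinearIndependent.pair_iff.2 fun s t hst =>
      LinearIndependent.pair_iff.1 huv s t (Subtype.ext hst)
  obtain ⟨j, hj⟩ := (isAntipodalForm_of_dependences hl hx u.2 v.2 huv').exists_ne 0
  have hu0 : (u : Fin 6 → ℝ) 0 = 0 := hu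
  have hv0 : (v : Fin 6 → ℝ) 0 = 0 := hv
  exact hj (by simp [hu0, hv0])

/-- The triangles `a` and `b` are parallel, and the edges of `a` alternate with the edges of `-b`
in the cyclic order of directions. This is encoded by cones: an edge of `a` is a nonnegative
combination of two edges of `b` that start at a common vertex, and conversely. -/
structure IsInterlacedPair (a b : Fin 3 → E) : Prop where
  left : ∀ i, ∃ c d : ℝ, 0 ≤ c ∧ 0 ≤ d ∧
    a (i + 1) - a i = c • (b i - b (i + 1)) + d • (b (i + 2) - b (i + 1))
  right : ∀ i, ∃ c d : ℝ, 0 ≤ c ∧ 0 ≤ d ∧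
    b i - b (i + 1) = c • (a (i + 1) - a i) + d • (a (i + 2) - a i)

theorem sum_six_eq {M : Type*} [AddCommMonoid M] {p q : Fin 3 → Fin 6}
    (h : Function.Bijective (Sum.elim p q)) (f : Fin 6 → M) (i : Fin 3) :
    ∑ j, f j = f (p i) + f (p (i + 1)) + f (p (i + 2)) +
      (f (q i) + f (q (i + 1)) + f (q (i + 2))) := by
  have hi : ∀ g : Fin 3 → M, ∑ j, g j = g i + g (i + 1) + g (i + 2) := by
    intro g
    rw [← Equiv.sum_comp (Equiv.addLeft i), Fin.sum_univ_three]
    simp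
  rw [← Equiv.sum_comp (Equiv.ofBijective _ h), Fintype.sum_sum_type]
  simp [hi]

/-- The rows of the Gale diagram at the vectors `p` and `q` express the edges of either triangle by
the edges of the other one. -/
theorem IsInterlacing.isInterlacedPair {x : Fin 6 → E} {D : Fin 6 → Fin 6 → ℝ}
    (hD : IsAntipodalForm D) (hDx : ∀ i, ∑ j, D i j • x j = 0) {p q : Fin 3 → Fin 6}
    (h : IsInterlacing D p q) : IsInterlacedPair (x ∘ p) (x ∘ q) := by
  have hsum : ∀ (r : Fin 3 → Fin 6) k, D k (r 0) + D k (r 1) + D k (r 2) = 0 →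
      ∀ i, D k (r i) + D k (r (i + 1)) + D k (r (i + 2)) = 0 := by
    intro r k hr i
    fin_cases i <;> simp <;> linarith
  have h3 : ∀ i : Fin 3, i + 2 + 1 = i := by decide
  have h4 : ∀ i : Fin 3, i + 2 + 2 = i + 1 := by decide
  have h5 : ∀ i : Fin 3, i + 1 + 1 = i + 2 := by decide
  constructor
  · intro i
    have e1 := hDx (p (i + 2))
    rw [sum_six_eq h.bijective _ i] at e1
    have e2 := hsum p _ (h.sum_left (p (i + 2))) i
    have e3 := hsum q _ (h.sum_right (p (i + 2))) i
    have e4 := h.pos_left (i + 2)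
    have e5 := h.nonneg₁ (i + 2)
    have e6 := h.nonneg₂ (i + 2)
    rw [h3] at e4 e6
    rw [hD.diag] at e1 e2
    set δ := D (p (i + 2)) (p i)
    refine ⟨D (p (i + 2)) (q i) / δ, D (p (i + 2)) (q (i + 2)) / δ, by positivity,
      by positivity, ?_⟩
    apply smul_right_injective E e4.ne'
    simp only [Function.comp, smul_add, smul_smul, mul_div_cancel₀ _ e4.ne']
    have e7 : D (p (i + 2)) (p (i + 1)) = -δ := by linarith
    have e8 : D (p (i + 2)) (q (i + 1)) = -(D (p (i + 2)) (q i) + D (p (i + 2)) (q (i + 2))) := by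
      linarith
    rw [e7, e8] at e1
    rw [← sub_eq_zero, ← neg_eq_zero, ← e1]
    module
  · intro i
    have e1 := hDx (q (i + 2))
    rw [sum_six_eq h.bijective _ i] at e1
    have e2 := hsum p _ (h.sum_left (q (i + 2))) i
    have e3 := hsum q _ (h.sum_right (q (i + 2))) i
    have e4 := h.pos_right (i + 2)
    have e5 := h.nonneg₁ (i + 2)
    have e6 := h.nonneg₂ (i + 1)
    rw [h3] at e4
    rw [h5] at e6
    rw [hD.antisymm] at e5 e6
    rw [hD.diag] at e1 e3
    set δ := D (q (i + 2)) (q i)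
    refine ⟨-D (q (i + 2)) (p (i + 1)) / δ, -D (q (i + 2)) (p (i + 2)) / δ, by positivity,
      by positivity, ?_⟩
    apply smul_right_injective E e4.ne'
    simp only [Function.comp, smul_add, smul_smul, mul_div_cancel₀ _ e4.ne']
    have e7 : D (q (i + 2)) (q (i + 1)) = -δ := by linarith
    have e8 : D (q (i + 2)) (p i) = -(D (q (i + 2)) (p (i + 1)) + D (q (i + 2)) (p (i + 2))) := by
      linarith
    rw [e7, e8] at e1
    rw [← sub_eq_zero, ← e1]
    module

/-- Six equidistant points of a three-dimensional space are the vertices of two parallel triangles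
that form an interlaced pair, and they do not lie in a plane. -/
theorem exists_isInterlacedPair (hE : Module.finrank ℝ E = 3) {x : Fin 6 → E} {l : ℝ} (hl : 0 < l)
    (hx : ∀ i j, i ≠ j → ‖x i - x j‖ = l) :
    (∃ p q : Fin 3 → Fin 6, Function.Bijective (Sum.elim p q) ∧
      IsInterlacedPair (x ∘ p) (x ∘ q)) ∧
    ∀ (f : E →ₗ[ℝ] ℝ) (c : ℝ), (∀ i, f (x i) = c) → f = 0 := by
  have hfin : Module.Finite ℝ E := Module.finite_of_finrank_pos (by omega)
  have h1 := LinearMap.finrank_range_add_finrank_ker (affineCombination x)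
  have h2 := finrank_ker_affineCombination_le hl hx
  have h3 := Submodule.finrank_le (LinearMap.range (affineCombination x))
  have h4 : Module.finrank ℝ (E × ℝ) = 4 := by
    rw [Module.finrank_prod, hE, Module.finrank_self]
  rw [Module.finrank_fintype_fun_eq_card, Fintype.card_fin] at h1
  constructor
  · obtain ⟨u, hu, v, hv, huv⟩ := exists_linearIndependent_pair_of_two_le
      (K := LinearMap.ker (affineCombination x)) (by omega)
    have hD := isAntipodalForm_of_dependences hl hx hu hv huv
    obtain ⟨p, q, hpq⟩ := hD.exists_isInterlacing
    refine ⟨p, q, hpq.bijective, hpq.isInterlacedPair hD fun i => ?_⟩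
    have e : ∀ j, (u i * v j - u j * v i) • x j = u i • v j • x j - v i • u j • x j := fun j => by
      module
    rw [Finset.sum_congr rfl fun j _ => e j, Finset.sum_sub_distrib, ← Finset.smul_sum,
      ← Finset.smul_sum, (mem_ker_affineCombination.1 hu).1, (mem_ker_affineCombination.1 hv).1]
    simp
  · intro f c hf
    have htop : LinearMap.range (affineCombination x) = ⊤ :=
      Submodule.eq_top_of_finrank_eq (by omega)
    ext e
    obtain ⟨k, hk⟩ := LinearMap.range_eq_top.1 htop (e, 0)
    simp only [affineCombination, LinearMap.prod_apply, Function.prod, Prod.mk.injEq,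
      Fintype.linearCombination_apply, smul_eq_mul, mul_one] at hk
    rw [← hk.1, map_sum]
    simp [hf, ← Finset.sum_mul, hk.2]

end

/-! ### Interlaced pairs of triangles and the hexagon of their differences -/

section

variable {E : Type*} [NormedAddCommGroup E] [NormedSpace ℝ E]

/-- The vertices of the hexagon `triangle a - triangle b` of an interlaced pair. -/
def differenceHexagon {V : Type*} [AddCommGroup V] (a b : Fin 3 → V) : Fin 6 → V :=
  ![a 0 - b 0, a 1 - b 0, a 1 - b 1, a 2 - b 1, a 2 - b 2, a 0 - b 2]

theorem mem_range_differenceHexagon {V : Type*} [AddCommGroup V] {a b : Fin 3 → V} (i : Fin 3) :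
    a i - b i ∈ Set.range (differenceHexagon a b) ∧
    a (i + 1) - b i ∈ Set.range (differenceHexagon a b) ∧
    a i - b (i + 2) ∈ Set.range (differenceHexagon a b) := by
  fin_cases i
  exacts [⟨⟨0, rfl⟩, ⟨1, rfl⟩, ⟨5, rfl⟩⟩, ⟨⟨2, rfl⟩, ⟨3, rfl⟩, ⟨1, rfl⟩⟩,
    ⟨⟨4, rfl⟩, ⟨5, rfl⟩, ⟨3, rfl⟩⟩]

theorem exists_differenceHexagon_eq {V : Type*} [AddCommGroup V] {a b : Fin 3 → V} (j : Fin 6) :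
    ∃ k m, differenceHexagon a b j = a k - b m := by
  fin_cases j
  exacts [⟨0, 0, rfl⟩, ⟨1, 0, rfl⟩, ⟨1, 1, rfl⟩, ⟨2, 1, rfl⟩, ⟨2, 2, rfl⟩, ⟨0, 2, rfl⟩]

theorem fin_three_cases (i k : Fin 3) : k = i ∨ k = i + 1 ∨ k = i + 2 := by
  revert i k; decide

theorem linearIndependent_edges {l : ℝ} (hl : 0 < l) {a : Fin 3 → E}
    (ha : IsEquilateralTriangle l a) (i : Fin 3) :
    LinearIndependent ℝ ![a (i + 1) - a i, a (i + 2) - a i] := by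
  have h1 : ‖a (i + 1) - a i‖ = l := ha _ _ ((by decide : ∀ i : Fin 3, i + 1 ≠ i) i)
  have h2 : ‖a (i + 2) - a i‖ = l := ha _ _ ((by decide : ∀ i : Fin 3, i + 2 ≠ i) i)
  have h3 : ‖a (i + 1) - a (i + 2)‖ = l :=
    ha _ _ ((by decide : ∀ i : Fin 3, i + 1 ≠ i + 2) i)
  rw [LinearIndependent.pair_iff]
  intro s t hst
  have habs : |s| = |t| := by
    have := congrArg norm (eq_neg_of_add_eq_zero_left hst)
    rw [norm_neg, norm_smul, norm_smul, h1, h2, Real.norm_eq_abs, Real.norm_eq_abs] at this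
    exact mul_right_cancel₀ hl.ne' this
  rcases abs_eq_abs.1 habs with rfl | rfl
  · rw [← smul_add, smul_eq_zero] at hst
    rcases hst with h | h
    · exact ⟨h, h⟩
    · -- The two edges would be opposite, and the third one would have length `2 * l`.
      exfalso
      have h4 : a (i + 1) - a (i + 2) = (2 : ℝ) • (a (i + 1) - a i) := by
        rw [eq_neg_of_add_eq_zero_right h |> (sub_eq_iff_eq_add.1 ·)]; module
      rw [h4, norm_smul, h1, Real.norm_eq_abs, abs_two] at h3
      linarith
  · have h4 : t • (a (i + 1) - a (i + 2)) = 0 := by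
      rw [← neg_eq_zero, ← hst]; module
    rw [smul_eq_zero, ← norm_eq_zero (a := a (i + 1) - a (i + 2)), h3] at h4
    have := h4.resolve_right hl.ne'
    simp [this]

theorem exists_dual_of_linearIndependent_pair {u v : E} (h : LinearIndependent ℝ ![u, v]) :
    ∃ f : E →ₗ[ℝ] ℝ, f u = 0 ∧ f v = 1 := by
  have hv : v ∉ Submodule.span ℝ {u} := by
    intro hv
    obtain ⟨c, hc⟩ := Submodule.mem_span_singleton.1 hv
    have := (LinearIndependent.pair_iff.1 h c (-1) (by rw [hc]; module)).2
    norm_num at this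
  obtain ⟨f, hf, hfv⟩ := LinearMap.exists_extend_of_notMem (0 : Submodule.span ℝ {u} →ₗ[ℝ] ℝ) hv 1
  refine ⟨f, ?_, hfv⟩
  exact LinearMap.congr_fun hf ⟨u, Submodule.mem_span_singleton_self u⟩

theorem finrank_eq_two_of_le_ker (hE : Module.finrank ℝ E = 3) {f : E →ₗ[ℝ] ℝ} (hf : f ≠ 0)
    {K : Submodule ℝ E} (hK : K ≤ LinearMap.ker f) {u v : E} (hu : u ∈ K) (hv : v ∈ K)
    (h : LinearIndependent ℝ ![u, v]) : Module.finrank ℝ K = 2 := by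
  have hfin : Module.Finite ℝ E := Module.finite_of_finrank_pos (by omega)
  have h1 := Submodule.finrank_mono hK
  have h2 := Module.Dual.finrank_ker_add_one_of_ne_zero hf
  have h3 : LinearIndependent ℝ ![(⟨u, hu⟩ : K), ⟨v, hv⟩] :=
    LinearIndependent.pair_iff.2 fun s t hst =>
      LinearIndependent.pair_iff.1 h s t (congrArg Subtype.val hst)
  have h4 := h3.fintype_card_le_finrank
  rw [Fintype.card_fin] at h4
  omega

namespace IsInterlacedPair

variable {a b : Fin 3 → E}

theorem smul (h : IsInterlacedPair a b) (r : ℝ) : IsInterlacedPair (r • a) (r • b) where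
  left i := by
    obtain ⟨c, d, hc, hd, e⟩ := h.left i
    refine ⟨c, d, hc, hd, ?_⟩
    simp only [Pi.smul_apply, ← smul_sub]
    rw [e]; module
  right i := by
    obtain ⟨c, d, hc, hd, e⟩ := h.right i
    refine ⟨c, d, hc, hd, ?_⟩
    simp only [Pi.smul_apply, ← smul_sub]
    rw [e]; module

theorem apply_right_eq (h : IsInterlacedPair a b) (f : E →ₗ[ℝ] ℝ) (hf : ∀ i j, f (a i) = f (a j))
    (i j : Fin 3) : f (b i) = f (b j) := by
  have hs : ∀ i, f (b i) = f (b (i + 1)) := by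
    intro i
    obtain ⟨c, d, -, -, e⟩ := h.right i
    have := congrArg f e
    simp only [map_sub, map_add, map_smul, smul_eq_mul, hf (i + 1) i, hf (i + 2) i] at this
    linarith
  have h2 : f (b (i + 1)) = f (b (i + 2)) := by rw [hs (i + 1)]; congr 2; revert i; decide
  rcases fin_three_cases i j with rfl | rfl | rfl
  · rfl
  · exact hs i
  · rw [hs, h2]

/-- A functional that is strictly maximal on `a` at `a i` is not strictly minimal on `b` at
`b (i + 1)`. -/
theorem not_strict (h : IsInterlacedPair a b) (f : E →ₗ[ℝ] ℝ) (i : Fin 3)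
    (h1 : f (a (i + 1)) < f (a i)) (h2 : f (b (i + 1)) < f (b i))
    (h3 : f (b (i + 1)) < f (b (i + 2))) : False := by
  obtain ⟨c, d, hc, hd, e⟩ := h.left i
  have := congrArg f e
  simp only [map_sub, map_add, map_smul, smul_eq_mul] at this
  have := mul_nonneg hc (sub_nonneg.2 h2.le)
  have := mul_nonneg hd (sub_nonneg.2 h3.le)
  linarith

/-- The triangles lie in parallel planes, which are distinct if the six points are not coplanar. -/
theorem exists_height (h : IsInterlacedPair a b) (hE : Module.finrank ℝ E = 3)
    (hspan : ∀ (f : E →ₗ[ℝ] ℝ) (c : ℝ), (∀ i, f (a i) = c) → (∀ i, f (b i) = c) → f = 0) :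
    ∃ f : E →ₗ[ℝ] ℝ, f ≠ 0 ∧ ∀ i j, f (a i) = f (b j) + 1 := by
  have hfin : Module.Finite ℝ E := Module.finite_of_finrank_pos (by omega)
  have hlt : Submodule.span ℝ (Set.range ![a 1 - a 0, a 2 - a 0]) < ⊤ := by
    rw [lt_top_iff_ne_top]
    intro htop
    have := finrank_range_le_card (R := ℝ) ![a 1 - a 0, a 2 - a 0]
    rw [Set.finrank, htop, finrank_top, hE, Fintype.card_fin] at this
    omega
  obtain ⟨f, hf, hle⟩ := Submodule.exists_le_ker_of_lt_top _ hlt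
  have h1 : f (a 1 - a 0) = 0 := hle (Submodule.subset_span ⟨0, rfl⟩)
  have h2 : f (a 2 - a 0) = 0 := hle (Submodule.subset_span ⟨1, rfl⟩)
  rw [map_sub, sub_eq_zero] at h1 h2
  have ha : ∀ i, f (a i) = f (a 0) := fun i => by fin_cases i <;> simp [h1, h2]
  have hb := h.apply_right_eq f fun i j => by rw [ha i, ha j]
  have hne : f (a 0) - f (b 0) ≠ 0 := fun h0 => hf (hspan f (f (a 0)) ha fun i => by
    rw [hb i 0]; linarith)
  refine ⟨(f (a 0) - f (b 0))⁻¹ • f, smul_ne_zero (inv_ne_zero hne) hf, fun i j => ?_⟩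
  rw [LinearMap.smul_apply, LinearMap.smul_apply, ha i, hb j 0, smul_eq_mul, smul_eq_mul]
  field_simp
  ring

/-- The alternative behind the two cases of the classification. Consider a norming functional `g`
of the difference `a i - b (i + 1)`, which is not a vertex of the hexagon `a - b`. If `g` is not
constant on the plane of `a`, then the edges of `a` and `b` on which it is extremal are opposite. -/
theorem exists_norming_or_add_eq (h : IsInterlacedPair a b) {l : ℝ} (hl : 0 < l)
    (ha : IsEquilateralTriangle l a) (hb : IsEquilateralTriangle l b)
    (hab : ∀ i j, ‖a i - b j‖ = l) (i : Fin 3) :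
    (∃ g : E →L[ℝ] ℝ, ‖g‖ = 1 ∧ ∀ i j, g (a i) = g (b j) + l) ∨
      a i + b i = a (i + 1) + b (i + 1) := by
  have hne : ‖a i - b (i + 1)‖ ≠ 0 := by rw [hab]; exact hl.ne'
  obtain ⟨g, hg, hgx⟩ := exists_dual_vector ℝ _ hne
  simp only [RCLike.ofReal_real_eq_id, id, hab, map_sub] at hgx
  have hle : ∀ i m, g (a i) - g (b m) ≤ l := by
    intro i m
    rw [← map_sub, ← hab i m]
    calc g (a i - b m) ≤ ‖g (a i - b m)‖ := le_abs_self _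
      _ ≤ ‖g‖ * ‖a i - b m‖ := g.le_opNorm _
      _ = ‖a i - b m‖ := by rw [hg, one_mul]
  have hmax : ∀ k, g (a k) ≤ g (a i) := fun k => by linarith [hle k (i + 1)]
  have hmin : ∀ k, g (b (i + 1)) ≤ g (b k) := fun k => by linarith [hle i k]
  have h1 : g (a (i + 1)) = g (a i) := by
    obtain ⟨c, d, hc, hd, e⟩ := h.left i
    have := congrArg g e
    simp only [map_sub, map_add, map_smul, smul_eq_mul] at this
    have := mul_nonneg hc (sub_nonneg.2 (hmin i))
    have := mul_nonneg hd (sub_nonneg.2 (hmin (i + 2)))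
    linarith [hmax (i + 1)]
  rcases (hmax (i + 2)).eq_or_lt with h2 | h2
  · left
    have hconst : ∀ k, g (a k) = g (a i) := fun k => by
      rcases fin_three_cases i k with rfl | rfl | rfl
      exacts [rfl, h1, h2]
    refine ⟨g, hg, fun k j => ?_⟩
    have := h.apply_right_eq g.toLinearMap (fun i j => (hconst i).trans (hconst j).symm) j (i + 1)
    simp only [ContinuousLinearMap.coe_coe] at this
    rw [hconst, this]
    linarith
  · right
    obtain ⟨c, d, hc, hd, e⟩ := h.right i
    have e' := congrArg g e
    simp only [map_sub, map_add, map_smul, smul_eq_mul, h1, sub_self, mul_zero, zero_add] at e'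
    have hd0 : d = 0 := by
      by_contra hd0
      have := mul_pos (lt_of_le_of_ne hd (Ne.symm hd0)) (sub_pos.2 h2)
      linarith [hmin i]
    rw [hd0, zero_smul, add_zero] at e
    have hc1 : c = 1 := by
      have := congrArg norm e
      rw [norm_smul, hb _ _ ((by decide : ∀ i : Fin 3, i ≠ i + 1) i),
        ha _ _ ((by decide : ∀ i : Fin 3, i + 1 ≠ i) i), Real.norm_eq_abs, abs_of_nonneg hc] at this
      exact (mul_right_cancel₀ hl.ne' (by linarith))
    rw [hc1, one_smul] at e
    rw [← sub_eq_zero] at e ⊢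
    rw [← e]; abel

/-- The remaining differences `a i - b (i + 1)` lie in the hexagon, since by `not_strict` they
cannot be separated from its vertices. -/
theorem convexHull_differenceHexagon (h : IsInterlacedPair a b) :
    convexHull ℝ (Set.range (differenceHexagon a b)) = triangle a - triangle b := by
  rw [triangle, triangle, ← convexHull_sub]
  apply Set.Subset.antisymm
  · apply convexHull_mono
    rintro _ ⟨j, rfl⟩
    obtain ⟨k, m, e⟩ := exists_differenceHexagon_eq (a := a) (b := b) j
    rw [e]
    exact Set.sub_mem_sub ⟨k, rfl⟩ ⟨m, rfl⟩
  · apply convexHull_min _ (convex_convexHull ℝ _)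
    rintro _ ⟨_, ⟨i, rfl⟩, _, ⟨j, rfl⟩, rfl⟩
    dsimp only
    rcases fin_three_cases i j with rfl | rfl | rfl
    · exact subset_convexHull ℝ _ (mem_range_differenceHexagon j).1
    · by_contra hnot
      obtain ⟨f, u, hlt, hu⟩ := geometric_hahn_banach_closed_point (convex_convexHull ℝ _)
        ((Set.finite_range (differenceHexagon a b)).isClosed_convexHull ℝ) hnot
      have h1 := hlt _ (subset_convexHull ℝ _ (mem_range_differenceHexagon i).1)
      have h2 := hlt _ (subset_convexHull ℝ _ (mem_range_differenceHexagon (i + 1)).1)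
      have h3 := hlt _ (subset_convexHull ℝ _ (mem_range_differenceHexagon i).2.2)
      rw [map_sub] at h1 h2 h3 hu
      exact h.not_strict f.toLinearMap i (by simp; linarith) (by simp; linarith)
        (by simp; linarith)
    · exact subset_convexHull ℝ _ (mem_range_differenceHexagon i).2.2

/-- The side of the hexagon from `a i - b i` to `a (i + 1) - b i`, which is an edge of `a`, is
supporting. -/
theorem supporting_left (h : IsInterlacedPair a b) {i : Fin 3}
    (hind : LinearIndependent ℝ ![a (i + 1) - a i, a (i + 2) - a i]) :
    ∃ f : E →ₗ[ℝ] ℝ, f (a (i + 1) - b i) = f (a i - b i) ∧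
      (∀ k m, f (a k - b m) ≤ f (a i - b i)) ∧ f (a (i + 2) - b (i + 2)) < f (a i - b i) := by
  obtain ⟨φ, h1, h2⟩ := exists_dual_of_linearIndependent_pair hind
  rw [map_sub] at h1 h2
  have e1 : φ (b (i + 1)) ≤ φ (b i) := by
    obtain ⟨c, d, hc, hd, e⟩ := h.right i
    have := congrArg φ e
    simp only [map_sub, map_add, map_smul, smul_eq_mul, h1, h2] at this
    linarith
  have e2 : φ (b (i + 2)) ≤ φ (b i) := by
    obtain ⟨c, d, hc, hd, e⟩ := h.right (i + 2)
    have := congrArg φ e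
    rw [(by decide : ∀ i : Fin 3, i + 2 + 1 = i) i,
      (by decide : ∀ i : Fin 3, i + 2 + 2 = i + 1) i] at this
    simp only [map_sub, map_add, map_smul, smul_eq_mul] at this
    have e3 : φ (a i) - φ (a (i + 2)) = -1 := by linarith
    have e4 : φ (a (i + 1)) - φ (a (i + 2)) = -1 := by linarith
    rw [e3, e4] at this
    linarith
  refine ⟨-φ, ?_, ?_, ?_⟩
  · simp only [LinearMap.neg_apply, map_sub]; linarith
  · intro k m
    simp only [LinearMap.neg_apply, map_sub]
    rcases fin_three_cases i k with hk | hk | hk <;>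
    rcases fin_three_cases i m with hm | hm | hm <;> rw [hk, hm] <;> linarith
  · simp only [LinearMap.neg_apply, map_sub]; linarith

/-- The side of the hexagon from `a (i + 1) - b i` to `a (i + 1) - b (i + 1)`, which is an edge of
`-b`, is supporting. -/
theorem supporting_right (h : IsInterlacedPair a b) {i : Fin 3}
    (hind : LinearIndependent ℝ ![b (i + 1) - b i, b (i + 2) - b i]) :
    ∃ f : E →ₗ[ℝ] ℝ, f (a (i + 1) - b (i + 1)) = f (a (i + 1) - b i) ∧
      (∀ k m, f (a k - b m) ≤ f (a (i + 1) - b i)) ∧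
      f (a i - b (i + 2)) < f (a (i + 1) - b i) := by
  obtain ⟨φ, h1, h2⟩ := exists_dual_of_linearIndependent_pair hind
  rw [map_sub] at h1 h2
  have h3 : φ (b i) - φ (b (i + 1)) = 0 := by linarith
  have h4 : φ (b (i + 2)) - φ (b (i + 1)) = 1 := by linarith
  have e1 : φ (a i) ≤ φ (a (i + 1)) := by
    obtain ⟨c, d, hc, hd, e⟩ := h.left i
    have := congrArg φ e
    simp only [map_sub, map_add, map_smul, smul_eq_mul, h3, h4] at this
    linarith
  have e2 : φ (a (i + 2)) ≤ φ (a (i + 1)) := by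
    obtain ⟨c, d, hc, hd, e⟩ := h.left (i + 1)
    have := congrArg φ e
    rw [(by decide : ∀ i : Fin 3, i + 1 + 1 = i + 2) i,
      (by decide : ∀ i : Fin 3, i + 1 + 2 = i) i] at this
    simp only [map_sub, map_add, map_smul, smul_eq_mul] at this
    have e3 : φ (b (i + 1)) - φ (b (i + 2)) = -1 := by linarith
    have e4 : φ (b i) - φ (b (i + 2)) = -1 := by linarith
    rw [e3, e4] at this
    linarith
  refine ⟨φ, ?_, ?_, ?_⟩
  · simp only [map_sub]; linarith
  · intro k m
    simp only [map_sub]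
    rcases fin_three_cases i k with hk | hk | hk <;>
    rcases fin_three_cases i m with hm | hm | hm <;> rw [hk, hm] <;> linarith
  · simp only [map_sub]; linarith

/-- The coefficients of an edge of `b` in the basis given by two edges of `a`. -/
theorem nonneg_of_eq (h : IsInterlacedPair a b) {i : Fin 3}
    (hind : LinearIndependent ℝ ![a (i + 1) - a i, a (i + 2) - a i]) {s t : ℝ}
    (hst : b i - b (i + 1) = s • (a (i + 1) - a i) + t • (a (i + 2) - a i)) : 0 ≤ s ∧ 0 ≤ t := by
  obtain ⟨c, d, hc, hd, e⟩ := h.right i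
  obtain ⟨h1, h2⟩ := LinearIndependent.pair_iff.1 hind (c - s) (d - t) (by
    rw [sub_smul, sub_smul, sub_add_sub_comm, ← e, ← hst, sub_self])
  constructor <;> linarith

theorem isSemiregularHexagon (h : IsInterlacedPair a b) (hE : Module.finrank ℝ E = 3) {l : ℝ}
    (hl : 0 < l) (ha : IsEquilateralTriangle l a) (hb : IsEquilateralTriangle l b)
    {f : E →ₗ[ℝ] ℝ} (hf : f ≠ 0) {r : ℝ} (hfr : ∀ i j, f (a i) = f (b j) + r) :
    IsSemiregularHexagon l (differenceHexagon a b) where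
  planar := by
    refine finrank_eq_two_of_le_ker hE hf ?_ (u := a 1 - a 0) (v := a 2 - a 0) ?_ ?_
      (linearIndependent_edges hl ha 0)
    · rw [vectorSpan, Submodule.span_le]
      rintro _ ⟨_, ⟨i, rfl⟩, _, ⟨j, rfl⟩, rfl⟩
      obtain ⟨k, m, e⟩ := exists_differenceHexagon_eq (a := a) (b := b) i
      obtain ⟨k', m', e'⟩ := exists_differenceHexagon_eq (a := a) (b := b) j
      simp only [e, e', SetLike.mem_coe, LinearMap.mem_ker, vsub_eq_sub, map_sub, hfr k m,
        hfr k' m']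
      ring
    · have := vsub_mem_vectorSpan ℝ (Set.mem_range_self (f := differenceHexagon a b) 1)
        (Set.mem_range_self 0)
      simpa [differenceHexagon] using this
    · have h1 := vsub_mem_vectorSpan ℝ (Set.mem_range_self (f := differenceHexagon a b) 4)
        (Set.mem_range_self 5)
      simpa [differenceHexagon] using h1
  injective:= by
    have d0 : ∀ i, b i - b (i + 1) =
        (-1 : ℝ) • (a (i + 1) - a i) + (0 : ℝ) • (a (i + 2) - a i) → False := fun i e => by
      have := (h.nonneg_of_eq (linearIndependent_edges hl ha i) e).1
      linarith
    have d1 : ∀ i, a i - b i ≠ a (i + 1) - b (i + 1) := fun i e => d0 i (by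
      rw [← sub_eq_zero] at e ⊢; rw [← neg_eq_zero, ← e]; module)
    have d2 : ∀ i, a (i + 1) - b i ≠ a (i + 2) - b (i + 1) := fun i e => by
      have := (h.nonneg_of_eq (s := 1) (t := -1) (linearIndependent_edges hl ha i) (by
        rw [← sub_eq_zero] at e ⊢; rw [← neg_eq_zero, ← e]; module)).2
      linarith
    have d3 : ∀ i, a i - b i ≠ a (i + 2) - b (i + 1) := fun i e => by
      have := (h.nonneg_of_eq (s := 0) (t := -1) (linearIndependent_edges hl ha i) (by
        rw [← sub_eq_zero] at e ⊢; rw [← neg_eq_zero, ← e]; module)).2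
      linarith
    have da : ∀ i, a (i + 1) ≠ a i := fun i e => by
      have := ha (i + 1) i ((by decide : ∀ i : Fin 3, i + 1 ≠ i) i)
      rw [e, sub_self, norm_zero] at this
      exact hl.ne this
    have db : ∀ i, b (i + 1) ≠ b i := fun i e => by
      have := hb (i + 1) i ((by decide : ∀ i : Fin 3, i + 1 ≠ i) i)
      rw [e, sub_self, norm_zero] at this
      exact hl.ne this
    have d4 : ∀ i, a i - b i ≠ a (i + 1) - b i := fun i e => da i (sub_left_inj.1 e).symm
    have d5 : ∀ i, a (i + 1) - b i ≠ a (i + 1) - b (i + 1) := fun i e =>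
      db i (sub_right_inj.1 e).symm
    rw [Function.Injective]
    intro i j e
    by_contra hij
    wlog hlt : i < j generalizing i j
    · exact this e.symm (Ne.symm hij) (lt_of_le_of_ne (not_lt.1 hlt) (Ne.symm hij))
    fin_cases i <;> fin_cases j <;> first
      | exact absurd hlt (by decide)
      | exact d1 0 e | exact d1 1 e | exact d1 2 e.symm
      | exact d2 0 e | exact d2 1 e | exact d2 2 e.symm
      | exact d3 0 e | exact d3 1 e.symm | exact d3 1 e | exact d3 2 e.symm
      | exact d4 0 e | exact d4 1 e | exact d4 2 e
      | exact d5 0 e | exact d5 1 e | exact d5 2 e.symm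
  supporting i := by
    have key : ∀ {x y z : E}, (∃ f : E →ₗ[ℝ] ℝ, f x = f y ∧ (∀ k m, f (a k - b m) ≤ f y) ∧
        f z < f y) → z ∈ Set.range (differenceHexagon a b) →
        ∃ f : E →ₗ[ℝ] ℝ, f x = f y ∧ (∀ j, f (differenceHexagon a b j) ≤ f y) ∧
        ∃ j, f (differenceHexagon a b j) < f y := by
      rintro x y z ⟨f, h1, h2, h3⟩ ⟨j, rfl⟩
      refine ⟨f, h1, fun j => ?_, j, h3⟩
      obtain ⟨k, m, e⟩ := exists_differenceHexagon_eq (a := a) (b := b) j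
      rw [e]
      exact h2 k m
    have kl : ∀ i : Fin 3, _ := fun i => key (h.supporting_left (linearIndependent_edges hl ha i))
      (mem_range_differenceHexagon (i + 2)).1
    have kr : ∀ i : Fin 3, _ := fun i => key (h.supporting_right (linearIndependent_edges hl hb i))
      (mem_range_differenceHexagon i).2.2
    fin_cases i
    exacts [kl 0, kr 0, kl 1, kr 1, kl 2, kr 2]
  side_length i := by
    fin_cases i
    · simpa [differenceHexagon] using ha 1 0 (by decide)
    · simpa [differenceHexagon] using hb 0 1 (by decide)
    · simpa [differenceHexagon] using ha 2 1 (by decide)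
    · simpa [differenceHexagon] using hb 1 2 (by decide)
    · simpa [differenceHexagon] using ha 0 2 (by decide)
    · simpa [differenceHexagon] using hb 2 0 (by decide)
  alternating_sum := by
    simp only [differenceHexagon, Matrix.cons_val]
    abel

end IsInterlacedPair

end

/-! ### Octahedra, faces and homothetic images -/

section

variable {E : Type*} [NormedAddCommGroup E] [NormedSpace ℝ E]

theorem IsEquilateral.of_isHomothetic {S T : Set E} (hT : IsEquilateral T)
    (h : IsHomothetic S T) : IsEquilateral S := by
  obtain ⟨l, hl, hT⟩ := hT
  obtain ⟨t, r, hr, rfl⟩ := h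
  refine ⟨r * l, mul_pos hr hl, ?_⟩
  rintro _ ⟨v, hv, rfl⟩ _ ⟨w, hw, rfl⟩ hne
  have hvw : v ≠ w := fun e => hne (by rw [e])
  simp only
  rw [add_sub_add_left_eq_sub, ← smul_sub, norm_smul, Real.norm_eq_abs, abs_of_pos hr,
    hT hv hw hvw]

theorem isEquilateral_octahedronVertices {e : Fin 3 → E}
    (h : octahedronSkeleton e ⊆ frontier (Metric.closedBall (0 : E) 1)) :
    IsEquilateral (octahedronVertices e) := by
  rw [frontier_closedBall _ one_ne_zero] at h
  have hnorm : ∀ x ∈ octahedronSkeleton e, ‖x‖ = 1 := fun x hx => by simpa using h hx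
  have hmem : ∀ i j, i ≠ j → ∀ x ∈ segment ℝ (e i) (e j) ∪ segment ℝ (e i) (-e j) ∪
      segment ℝ (-e i) (-e j), x ∈ octahedronSkeleton e := fun i j hij x hx =>
    Set.mem_iUnion.2 ⟨i, Set.mem_iUnion.2 ⟨j, Set.mem_iUnion.2 ⟨hij, hx⟩⟩⟩
  have hmid : ∀ u v : E, ‖midpoint ℝ u v‖ = 1 → ‖u + v‖ = 2 := fun u v huv => by
    rw [midpoint_eq_smul_add, norm_smul] at huv
    norm_num at huv
    linarith
  have hadd : ∀ i j, ‖e i + e j‖ = 2 := fun i j => by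
    rcases eq_or_ne i j with rfl | hij
    · have hne : i ≠ i + 1 := (by decide : ∀ i : Fin 3, i ≠ i + 1) i
      rw [← two_smul ℝ, norm_smul,
        hnorm _ (hmem i (i + 1) hne _ (Or.inl (Or.inl (left_mem_segment ℝ _ _))))]
      norm_num
    · exact hmid _ _ (hnorm _ (hmem i j hij _ (Or.inl (Or.inl (midpoint_mem_segment _ _)))))
  have hsub : ∀ i j, i ≠ j → ‖e i - e j‖ = 2 := fun i j hij => by
    rw [sub_eq_add_neg]
    exact hmid _ _ (hnorm _ (hmem i j hij _ (Or.inl (Or.inr (midpoint_mem_segment _ _)))))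
  refine ⟨2, two_pos, ?_⟩
  rintro _ (⟨i, rfl⟩ | ⟨i, rfl⟩) _ (⟨j, rfl⟩ | ⟨j, rfl⟩) hne
  · exact hsub i j fun e => hne (by rw [e])
  · simp only [sub_neg_eq_add, hadd]
  · simp only
    rw [← neg_add', norm_neg, hadd]
  · simp only
    rw [neg_sub_neg]
    exact hsub j i fun e => hne (by rw [e])

/-- A two-dimensional face of the unit ball contains no interior point: otherwise it would contain a
point in every direction. -/
theorem norm_eq_one_of_mem_face (hE : Module.finrank ℝ E = 3) {F : Set E}
    (hF : IsTwoDimFace (Metric.closedBall (0 : E) 1) F) {w : E} (hw : w ∈ F) : ‖w‖ = 1 := by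
  have hw1 : ‖w‖ ≤ 1 := by simpa using hF.isExtreme.subset hw
  by_contra hne
  have hlt : ‖w‖ < 1 := lt_of_le_of_ne hw1 hne
  have htop : vectorSpan ℝ F = ⊤ := by
    rw [eq_top_iff]
    intro v _
    rcases eq_or_ne v 0 with rfl | hv
    · exact Submodule.zero_mem _
    have hv' : 0 < ‖v‖ := norm_pos_iff.2 hv
    set ε := (1 - ‖w‖) / ‖v‖ with hε
    have hε' : 0 < ε := div_pos (by linarith) hv'
    have hεv : ‖ε • v‖ = 1 - ‖w‖ := by
      rw [norm_smul, Real.norm_eq_abs, abs_of_pos hε', hε, div_mul_cancel₀ _ hv'.ne']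
    have h1 : w + ε • v ∈ Metric.closedBall (0 : E) 1 := by
      have := norm_add_le w (ε • v)
      rw [mem_closedBall_zero_iff]; linarith
    have h2 : w - ε • v ∈ Metric.closedBall (0 : E) 1 := by
      have := norm_sub_le w (ε • v)
      rw [mem_closedBall_zero_iff]; linarith
    have h3 : w ∈ openSegment ℝ (w + ε • v) (w - ε • v) :=
      ⟨1 / 2, 1 / 2, by norm_num, by norm_num, by norm_num, by module⟩
    have h4 := vsub_mem_vectorSpan ℝ (hF.isExtreme.left_mem_of_mem_openSegment h1 h2 hw h3) hw
    rw [vsub_eq_sub, add_sub_cancel_left] at h4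
    exact (Submodule.smul_mem_iff _ hε'.ne').1 h4
  have := hF.finrank_eq
  rw [htop, finrank_top] at this
  omega

theorem isEquilateral_range_union {V : Type*} [NormedAddCommGroup V] {l : ℝ} (hl : 0 < l)
    {a b : Fin 3 → V}
    (ha : IsEquilateralTriangle l a) (hb : IsEquilateralTriangle l b)
    (hab : ∀ i j, ‖a i - b j‖ = l) : IsEquilateral (Set.range a ∪ Set.range b) := by
  refine ⟨l, hl, ?_⟩
  rintro _ (⟨i, rfl⟩ | ⟨i, rfl⟩) _ (⟨j, rfl⟩ | ⟨j, rfl⟩) hne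
  · exact ha i j fun e => hne (by rw [e])
  · exact hab i j
  · rw [norm_sub_rev, hab]
  · exact hb i j fun e => hne (by rw [e])

theorem IsEquilateralTriangle.smul {l r : ℝ} (hr : 0 < r) {a : Fin 3 → E}
    (ha : IsEquilateralTriangle l a) : IsEquilateralTriangle (r * l) (r • a) := fun i j hij => by
  rw [Pi.smul_apply, Pi.smul_apply, ← smul_sub, norm_smul, Real.norm_eq_abs, abs_of_pos hr,
    ha i j hij]

theorem IsEquilateralTriangle.injective {V : Type*} [NormedAddCommGroup V] {l : ℝ} (hl : 0 < l)
    {a : Fin 3 → V} (ha : IsEquilateralTriangle l a) : Function.Injective a := fun i j e => by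
  by_contra hij
  have := ha i j hij
  rw [e, sub_self, norm_zero] at this
  exact hl.ne this

theorem exists_parallel_planes (hE : Module.finrank ℝ E = 3) {f : E →ₗ[ℝ] ℝ} (hf : f ≠ 0)
    (x y : E) : ∃ P Q : AffineSubspace ℝ E, IsPlane P ∧ IsPlane Q ∧ P.Parallel Q ∧
      (∀ z, z ∈ P ↔ f z = f x) ∧ ∀ z, z ∈ Q ↔ f z = f y := by
  have hfin : Module.Finite ℝ E := Module.finite_of_finrank_pos (by omega)
  have hker : Module.finrank ℝ (LinearMap.ker f) = 2 := by
    have := Module.Dual.finrank_ker_add_one_of_ne_zero hf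
    omega
  have hplane : ∀ x, IsPlane (AffineSubspace.mk' x (LinearMap.ker f)) := fun x =>
    ⟨AffineSubspace.mk'_nonempty _ _, by rw [AffineSubspace.direction_mk']; exact hker⟩
  have hmem : ∀ x z, z ∈ AffineSubspace.mk' x (LinearMap.ker f) ↔ f z = f x := fun x z => by
    rw [AffineSubspace.mem_mk', LinearMap.mem_ker, vsub_eq_sub, map_sub, sub_eq_zero]
  refine ⟨_, _, hplane x, hplane y, ?_, hmem x, hmem y⟩
  rw [AffineSubspace.parallel_iff_direction_eq_and_eq_bot_iff_eq_bot,
    AffineSubspace.direction_mk', AffineSubspace.direction_mk']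
  refine ⟨rfl, iff_of_false ?_ ?_⟩ <;> intro h
  · have := (hplane x).1
    rw [h] at this
    exact Set.not_nonempty_empty this
  · have := (hplane y).1
    rw [h] at this
    exact Set.not_nonempty_empty this

theorem norm_eq_one_of_mem_segment {u v : E} (hu : ‖u‖ = 1) (hv : ‖v‖ = 1) (huv : ‖u + v‖ = 2)
    {x : E} (hx : x ∈ segment ℝ u v) : ‖x‖ = 1 := by
  obtain ⟨s, t, hs, ht, hst, rfl⟩ := hx
  have hle : ∀ s t : ℝ, 0 ≤ s → 0 ≤ t → s + t = 1 → ‖s • u + t • v‖ ≤ 1 := by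
    intro s t hs ht hst
    have := norm_add_le (s • u) (t • v)
    rw [norm_smul, norm_smul, hu, hv, Real.norm_eq_abs, Real.norm_eq_abs, abs_of_nonneg hs,
      abs_of_nonneg ht] at this
    linarith
  have h1 := hle s t hs ht hst
  have h2 := hle t s ht hs (by linarith)
  -- The points with coefficients `s, t` and `t, s` add up to `u + v`.
  have h3 := norm_add_le (s • u + t • v) (t • u + s • v)
  rw [show s • u + t • v + (t • u + s • v) = (s + t) • (u + v) by module, hst, one_smul, huv] at h3
  linarith

/-- If opposite vertices of two triangles have a common midpoint, then the six points are the
vertices of an octahedron. -/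
theorem exists_octahedron {l : ℝ} (hl : 0 < l) {a b : Fin 3 → E}
    (ha : IsEquilateralTriangle l a) (hab : ∀ i j, ‖a i - b j‖ = l)
    {f : E →ₗ[ℝ] ℝ} (hf : ∀ i j, f (a i) = f (b j) + 1)
    (hsum : ∀ i, a i + b i = a (i + 1) + b (i + 1)) :
    ∃ e : Fin 3 → E, LinearIndependent ℝ e ∧
      octahedronSkeleton e ⊆ frontier (Metric.closedBall (0 : E) 1) ∧
      IsHomothetic (Set.range a ∪ Set.range b) (octahedronVertices e) := by
  obtain ⟨s, hs⟩ : ∃ s, ∀ i, b i = s - a i := by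
    refine ⟨a 0 + b 0, fun i => eq_sub_of_add_eq' ?_⟩
    have h1 : a 0 + b 0 = a 1 + b 1 := hsum 0
    have h2 : a 1 + b 1 = a 2 + b 2 := hsum 1
    fin_cases i
    exacts [rfl, h1.symm, (h1.trans h2).symm]
  set e : Fin 3 → E := fun i => l⁻¹ • (a i - b i) with he
  have hinv : ‖l⁻¹‖ = l⁻¹ := by rw [Real.norm_eq_abs, abs_of_pos (inv_pos.2 hl)]
  have hscale : ∀ x : E, ‖x‖ = l → ‖(2 * l⁻¹) • x‖ = 2 := fun x hx => by
    rw [norm_smul, norm_mul, hinv, hx, mul_assoc, inv_mul_cancel₀ hl.ne']; norm_num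
  have h1 : ∀ i, ‖e i‖ = 1 := fun i => by
    rw [he, norm_smul, hinv, hab, inv_mul_cancel₀ hl.ne']
  have hsub : ∀ i j, i ≠ j → ‖e i - e j‖ = 2 := fun i j hij => by
    rw [← hscale _ (ha i j hij)]
    congr 1
    simp only [he, hs]
    module
  have hadd : ∀ i j, ‖e i + e j‖ = 2 := fun i j => by
    rw [← hscale _ (hab i j)]
    congr 1
    simp only [he, hs]
    module
  refine ⟨e, ?_, ?_, ?_⟩
  · rw [Fintype.linearIndependent_iff]
    intro c hc
    rw [Fin.sum_univ_three] at hc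
    have hfe : ∀ i, f (e i) = l⁻¹ := fun i => by
      rw [he, map_smul, map_sub, hf i i, smul_eq_mul]; ring
    have hc0 : c 0 + c 1 + c 2 = 0 := by
      have := congrArg f hc
      simp only [map_add, map_smul, smul_eq_mul, hfe, map_zero] at this
      rw [← add_mul, ← add_mul] at this
      exact (mul_eq_zero.1 this).resolve_right (inv_ne_zero hl.ne')
    have hc0' : c 0 = -(c 1 + c 2) := by linarith
    have hedge : c 1 • (a (0 + 1) - a 0) + c 2 • (a (0 + 2) - a 0) = 0 := by
      have h2l : (2 * l⁻¹) ≠ 0 := mul_ne_zero two_ne_zero (inv_ne_zero hl.ne')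
      apply smul_right_injective E h2l
      simp only [smul_zero]
      rw [← hc, hc0']
      simp only [he, hs, zero_add]
      module
    obtain ⟨h2, h3⟩ := LinearIndependent.pair_iff.1 (linearIndependent_edges hl ha 0) _ _ hedge
    intro i
    fin_cases i
    exacts [by simp [hc0', h2, h3], h2, h3]
  · rw [frontier_closedBall _ one_ne_zero]
    intro x hx
    simp only [octahedronSkeleton, Set.mem_iUnion] at hx
    obtain ⟨i, j, hij, (hx | hx) | hx⟩ := hx <;> rw [mem_sphere_zero_iff_norm]
    · exact norm_eq_one_of_mem_segment (h1 i) (h1 j) (hadd i j) hx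
    · exact norm_eq_one_of_mem_segment (h1 i) (by rw [norm_neg, h1])
        (by rw [← sub_eq_add_neg, hsub i j hij]) hx
    · exact norm_eq_one_of_mem_segment (by rw [norm_neg, h1]) (by rw [norm_neg, h1])
        (by rw [← neg_add, norm_neg, hadd]) hx
  · refine ⟨(1 / 2 : ℝ) • s, l / 2, by positivity, ?_⟩
    have hl' : l / 2 * l⁻¹ = 1 / 2 := by field_simp
    have ea : ∀ i, (1 / 2 : ℝ) • s + (l / 2) • e i = a i := fun i => by
      simp only [he, hs, smul_smul, hl']; module
    have eb : ∀ i, (1 / 2 : ℝ) • s + (l / 2) • -e i = b i := fun i => by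
      simp only [he, hs, smul_smul, smul_neg, hl']; module
    rw [octahedronVertices, Set.image_union, ← Set.range_comp, ← Set.range_comp]
    simp only [Function.comp_def, ea, eb]

theorem toLinearMap_ne_zero_of_height {a b : Fin 3 → E} {g : E →L[ℝ] ℝ}
    (hgab : ∀ i j, g (a i) = g (b j) + 1) : g.toLinearMap ≠ 0 := by
  intro h0
  have h1 : ∀ x, g x = 0 := fun x => LinearMap.congr_fun h0 x
  have h2 := hgab 0 0
  rw [h1, h1] at h2
  norm_num at h2

theorem isTwoDimFace_of_norming (hE : Module.finrank ℝ E = 3) {a b : Fin 3 → E}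
    (ha : IsEquilateralTriangle 1 a) (hab : ∀ i j, ‖a i - b j‖ = 1) {g : E →L[ℝ] ℝ}
    (hg : ‖g‖ = 1) (hgab : ∀ i j, g (a i) = g (b j) + 1) :
    IsTwoDimFace (Metric.closedBall (0 : E) 1) (Metric.closedBall (0 : E) 1 ∩ {x | g x = 1}) where
  convex := (convex_closedBall _ _).inter (convex_hyperplane g.toLinearMap.isLinear 1)
  isExtreme := by
    refine ⟨Set.inter_subset_left, ?_⟩
    rintro x hx y hy z ⟨-, hz⟩ ⟨s, t, hs, ht, hst, rfl⟩
    have hle : ∀ x ∈ Metric.closedBall (0 : E) 1, g x ≤ 1 := fun x hx => by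
      rw [mem_closedBall_zero_iff] at hx
      calc g x ≤ ‖g x‖ := le_abs_self _
        _ ≤ ‖g‖ * ‖x‖ := g.le_opNorm x
        _ ≤ 1 := by rw [hg, one_mul]; exact hx
    refine ⟨hx, le_antisymm (hle x hx) ?_⟩
    simp only [Set.mem_ofPred_eq, map_add, map_smul, smul_eq_mul] at hz
    have h1 := mul_le_mul_of_nonneg_left (hle y hy) ht.le
    have h2 : s * 1 ≤ s * g x := by linarith
    exact le_of_mul_le_mul_left h2 hs
  finrank_eq := by
    have hg0 := toLinearMap_ne_zero_of_height hgab
    have hmem : ∀ i, a i - b 0 ∈ Metric.closedBall (0 : E) 1 ∩ {x | g x = 1} := fun i =>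
      ⟨by rw [mem_closedBall_zero_iff, hab], by simp [hgab i 0]⟩
    have hedge : ∀ i, a i - a 0 ∈
        vectorSpan ℝ (Metric.closedBall (0 : E) 1 ∩ {x | g x = 1}) := fun i => by
      have := vsub_mem_vectorSpan ℝ (hmem i) (hmem 0)
      rwa [vsub_eq_sub, sub_sub_sub_cancel_right] at this
    refine finrank_eq_two_of_le_ker hE hg0 ?_ (hedge 1) (hedge 2)
      (linearIndependent_edges one_pos ha 0)
    rw [vectorSpan, Submodule.span_le]
    rintro _ ⟨x, ⟨-, hx⟩, y, ⟨-, hy⟩, rfl⟩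
    rw [Set.mem_ofPred_eq] at hx hy
    simp [hx, hy]

theorem triangle_subset_affineSubspace {P : AffineSubspace ℝ E} {a : Fin 3 → E}
    (h : ∀ i, a i ∈ P) : triangle a ⊆ P :=
  convexHull_min (by rintro _ ⟨i, rfl⟩; exact h i) P.convex

/-- An interlaced pair of triangles whose differences lie on a supporting hyperplane of the unit
ball. -/
theorem exists_hexagon_face (hE : Module.finrank ℝ E = 3) {a b : Fin 3 → E}
    (h : IsInterlacedPair a b) (ha : IsEquilateralTriangle 1 a) (hb : IsEquilateralTriangle 1 b)
    (hab : ∀ i j, ‖a i - b j‖ = 1) {g : E →L[ℝ] ℝ}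
    (hg : ‖g‖ = 1) (hgab : ∀ i j, g (a i) = g (b j) + 1) :
    ∃ (F : Set E) (p : Fin 6 → E),
      (∃ P Q : AffineSubspace ℝ E, IsPlane P ∧ IsPlane Q ∧ P.Parallel Q ∧
        triangle a ⊆ P ∧ triangle b ⊆ Q) ∧
      IsTwoDimFace (Metric.closedBall (0 : E) 1) F ∧
      IsSemiregularHexagon 1 p ∧
      convexHull ℝ (Set.range p) = triangle a - triangle b ∧
      triangle a - triangle b ⊆ F := by
  have hg0 := toLinearMap_ne_zero_of_height hgab
  have hface := isTwoDimFace_of_norming hE ha hab hg hgab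
  refine ⟨_, differenceHexagon a b, ?_, hface, h.isSemiregularHexagon hE one_pos ha hb hg0 hgab,
    h.convexHull_differenceHexagon, ?_⟩
  · obtain ⟨P, Q, hP, hQ, hPQ, hmP, hmQ⟩ := exists_parallel_planes hE hg0 (a 0) (b 0)
    refine ⟨P, Q, hP, hQ, hPQ, triangle_subset_affineSubspace fun i => ?_,
      triangle_subset_affineSubspace fun i => ?_⟩
    · rw [hmP]
      exact (hgab i 0).trans (hgab 0 0).symm
    · rw [hmQ]
      exact add_right_cancel ((hgab 0 i).symm.trans (hgab 0 0))
  · rw [← h.convexHull_differenceHexagon]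
    refine convexHull_min ?_ hface.convex
    rintro _ ⟨j, rfl⟩
    obtain ⟨k, m, e⟩ := exists_differenceHexagon_eq (a := a) (b := b) j
    rw [e]
    exact ⟨by rw [mem_closedBall_zero_iff, hab], by simp [hgab k m]⟩

/-- Six equidistant points are the vertices of an interlaced pair of triangles at heights that
differ by `1`. -/
theorem IsEquilateral.exists_isInterlacedPair (hE : Module.finrank ℝ E = 3) {S : Set E}
    (hS : S.ncard = 6) (h : IsEquilateral S) :
    ∃ (l : ℝ) (a b : Fin 3 → E) (f : E →ₗ[ℝ] ℝ), 0 < l ∧ S = Set.range a ∪ Set.range b ∧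
      IsEquilateralTriangle l a ∧ IsEquilateralTriangle l b ∧ (∀ i j, ‖a i - b j‖ = l) ∧
      IsInterlacedPair a b ∧ f ≠ 0 ∧ ∀ i j, f (a i) = f (b j) + 1 := by
  obtain ⟨l, hl, hSl⟩ := h
  have hfin : Finite S := Set.finite_of_ncard_ne_zero (by omega)
  have e : Fin 6 ≃ S := (Finite.equivFinOfCardEq (by rw [Nat.card_coe_set_eq, hS])).symm
  have hx : ∀ i j, i ≠ j → ‖(e i : E) - e j‖ = l := fun i j hij =>
    hSl (e i).2 (e j).2 fun h0 => hij (e.injective (Subtype.ext h0))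
  obtain ⟨⟨p, q, hbij, hpair⟩, hspan⟩ := _root_.exists_isInterlacedPair hE
    (x := fun i => (e i : E)) hl hx
  have hp : ∀ i j, i ≠ j → p i ≠ p j := fun i j hij h0 =>
    hij (Sum.inl_injective (hbij.1 (a₁ := Sum.inl i) (a₂ := Sum.inl j) h0))
  have hq : ∀ i j, i ≠ j → q i ≠ q j := fun i j hij h0 =>
    hij (Sum.inr_injective (hbij.1 (a₁ := Sum.inr i) (a₂ := Sum.inr j) h0))
  have hpq : ∀ i j, p i ≠ q j := fun i j h0 =>
    Sum.inl_ne_inr (hbij.1 (a₁ := Sum.inl i) (a₂ := Sum.inr j) h0)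
  obtain ⟨f, hf, hfab⟩ := hpair.exists_height hE fun f c ha hb => hspan f c fun i => by
    obtain ⟨j | j, rfl⟩ := hbij.2 i
    exacts [ha j, hb j]
  refine ⟨l, _, _, f, hl, ?_, fun i j hij => hx _ _ (hp i j hij),
    fun i j hij => hx _ _ (hq i j hij), fun i j => hx _ _ (hpq i j), hpair, hf, hfab⟩
  ext y
  constructor
  · intro hy
    obtain ⟨i, hi⟩ := e.surjective ⟨y, hy⟩
    obtain ⟨j | j, rfl⟩ := hbij.2 i
    exacts [Or.inl ⟨j, congrArg Subtype.val hi⟩, Or.inr ⟨j, congrArg Subtype.val hi⟩]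
  · rintro (⟨j, rfl⟩ | ⟨j, rfl⟩)
    exacts [(e (p j)).2, (e (q j)).2]

end

theorem theorem3 {E : Type*} [NormedAddCommGroup E] [NormedSpace ℝ E]
    (hE : Module.finrank ℝ E = 3) (S : Set E) (hS : S.ncard = 6) :
    (IsEquilateral S ↔
      (∃ e : Fin 3 → E, LinearIndependent ℝ e ∧
        octahedronSkeleton e ⊆ frontier (Metric.closedBall (0 : E) 1) ∧
        IsHomothetic S (octahedronVertices e)) ∨
      (∃ (a b : Fin 3 → E) (F : Set E) (p : Fin 6 → E),
        IsEquilateralTriangle 1 a ∧ IsEquilateralTriangle 1 b ∧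
        (∃ P Q : AffineSubspace ℝ E, IsPlane P ∧ IsPlane Q ∧ P.Parallel Q ∧
          triangle a ⊆ P ∧ triangle b ⊆ Q) ∧
        IsTwoDimFace (Metric.closedBall (0 : E) 1) F ∧
        IsSemiregularHexagon 1 p ∧
        convexHull ℝ (Set.range p) = triangle a - triangle b ∧
        triangle a - triangle b ⊆ F ∧
        IsHomothetic S (Set.range a ∪ Set.range b))) ∧
    (IsEquilateral S →
      ∃ P Q : AffineSubspace ℝ E, IsPlane P ∧ IsPlane Q ∧ P.Parallel Q ∧ P ≠ Q ∧
        (S ∩ P).ncard = 3 ∧ (S ∩ Q).ncard = 3) := by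
  refine ⟨⟨fun h => ?_, ?_⟩, fun h => ?_⟩
  · obtain ⟨l, a, b, f, hl, rfl, ha, hb, hab, hpair, hf, hfab⟩ := h.exists_isInterlacedPair hE hS
    by_cases hg : ∃ g : E →L[ℝ] ℝ, ‖g‖ = 1 ∧ ∀ i j, g (a i) = g (b j) + l
    · right
      obtain ⟨g, hg, hgab⟩ := hg
      have hl' : l⁻¹ * l = 1 := inv_mul_cancel₀ hl.ne'
      have ha' := ha.smul (inv_pos.2 hl)
      have hb' := hb.smul (inv_pos.2 hl)
      rw [hl'] at ha' hb'
      have hab' : ∀ i j, ‖(l⁻¹ • a) i - (l⁻¹ • b) j‖ = 1 := fun i j => by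
        rw [Pi.smul_apply, Pi.smul_apply, ← smul_sub, norm_smul, hab, Real.norm_eq_abs,
          abs_of_pos (inv_pos.2 hl), hl']
      obtain ⟨F, p, h1, h2, h3, h4, h5⟩ := exists_hexagon_face hE (hpair.smul l⁻¹) ha' hb' hab' hg
        fun i j => by
          rw [Pi.smul_apply, Pi.smul_apply, map_smul, map_smul, hgab i j, smul_add,
            smul_eq_mul l⁻¹ l, hl']
      refine ⟨_, _, F, p, ha', hb', h1, h2, h3, h4, h5, 0, l, hl, ?_⟩
      rw [Set.image_union, ← Set.range_comp, ← Set.range_comp]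
      simp [Function.comp_def, smul_smul, mul_inv_cancel₀ hl.ne']
    · left
      exact exists_octahedron hl ha hab hfab fun i =>
        (hpair.exists_norming_or_add_eq hl ha hb hab i).resolve_left hg
  · rintro (⟨e, -, he, hSe⟩ | ⟨a, b, F, p, ha, hb, -, hF, -, -, habF, hSab⟩)
    · exact (isEquilateral_octahedronVertices he).of_isHomothetic hSe
    · refine (isEquilateral_range_union one_pos ha hb fun i j => ?_).of_isHomothetic hSab
      exact norm_eq_one_of_mem_face hE hF (habF (Set.sub_mem_sub
        (subset_convexHull ℝ _ ⟨i, rfl⟩) (subset_convexHull ℝ _ ⟨j, rfl⟩)))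
  · obtain ⟨l, a, b, f, hl, rfl, ha, hb, hab, hpair, hf, hfab⟩ := h.exists_isInterlacedPair hE hS
    obtain ⟨P, Q, hP, hQ, hPQ, hmP, hmQ⟩ := exists_parallel_planes hE hf (a 0) (b 0)
    have ha0 : ∀ i, f (a i) = f (a 0) := fun i => (hfab i 0).trans (hfab 0 0).symm
    have hb0 : ∀ j, f (b j) = f (b 0) := fun j =>
      add_right_cancel ((hfab 0 j).symm.trans (hfab 0 0))
    have hne : f (a 0) ≠ f (b 0) := by rw [hfab 0 0]; simp
    refine ⟨P, Q, hP, hQ, hPQ, ?_, ?_, ?_⟩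
    · rintro rfl
      exact hne ((hmQ _).1 ((hmP _).2 rfl))
    · have : (Set.range a ∪ Set.range b) ∩ P = Set.range a := by
        ext y
        simp only [Set.mem_inter_iff, SetLike.mem_coe, hmP]
        constructor
        · rintro ⟨hy | ⟨j, rfl⟩, hy'⟩
          · exact hy
          · exact absurd ((hb0 j).symm.trans hy').symm hne
        · rintro ⟨i, rfl⟩
          exact ⟨Or.inl ⟨i, rfl⟩, ha0 i⟩
      rw [this, Set.ncard_range_of_injective (ha.injective hl), Nat.card_fin]
    · have : (Set.range a ∪ Set.range b) ∩ Q = Set.range b := by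
        ext y
        simp only [Set.mem_inter_iff, SetLike.mem_coe, hmQ]
        constructor
        · rintro ⟨⟨i, rfl⟩ | hy, hy'⟩
          · exact absurd ((ha0 i).symm.trans hy') hne
          · exact hy
        · rintro ⟨i, rfl⟩
          exact ⟨Or.inr ⟨i, rfl⟩, hb0 i⟩
      rw [this, Set.ncard_range_of_injective (hb.injective hl), Nat.card_fin]
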